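/- A parking function of length $n$ is a vector $(p_1,\dots,p_n)$ of integers with $1\le p_i\le n$ whose weakly increasing rearrangement $p_{(1)}\le\dots\le p_{(n)}$ satisfies $p_{(i)}\le i$ for $1\le i\le n$. Its area is $\frac{n(n+1)}{2}-(p_1+\dots+p_n)$. Let a parking function of length $n$ be drawn uniformly at random, and let $E_1(n)$ be the expectation of its area, that is, $$E_1(n)=-\frac n2+\frac12\,\frac{(n+1)!}{(n+1)^n}\sum_{k=0}^{n-1}\frac{(n+1)^k}{k!}.$$ Theorem 5. For every $n$, the fifth factorial moment of the area $X$ on parking functions of length $n$, i.e. the expectation of $X(X-1)(X-2)(X-3)(X-4)$, equals $$-\frac{105845}{110592}n^7-\frac{2170159}{290304}n^6-\frac{99955651}{3870720}n^5-\frac{30773609}{725760}n^4-\frac{94846903}{11612160}n^3+\frac{24676991}{483840}n^2+\frac{392763901}{11612160}n$$ $$+\left(\frac{565}{2048}n^6+\frac{1005}{128}n^5+\frac{9832585}{165888}n^4+\frac{1111349}{5184}n^3+\frac{826358527}{1935360}n^2+\frac{159943787}{362880}n+\frac{1024580441}{5806080}\right)E_1(n),$$ and asymptotically, as $n\to\infty$,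 it equals $\frac{565}{8192}\sqrt{2\pi}\,n^{15/2}+O(n^7)$. -/

import Mathlib

/-- A vector `(p 0, …, p (n-1))` of integers with `1 ≤ p i ≤ n` is a parking function of length `n`
if its weakly increasing rearrangement `q = p ∘ Tuple.sort p` satisfies
`q_(i) ≤ i` for `i = 1, …, n` (positions are numbered from `0` here, hence the `+ 1`). -/
def IsParkingFunction (n : ℕ) (p : Fin n → ℕ) : Prop :=
  (∀ i, 1 ≤ p i ∧ p i ≤ n) ∧ ∀ i : Fin n, (p ∘ Tuple.sort p) i ≤ (i : ℕ) + 1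

open Classical in
/-- The finite set of all parking functions of length `n`. -/
noncomputable def parkingFunctions (n : ℕ) : Finset (Fin n → ℕ) :=
  (Fintype.piFinset fun _ : Fin n => Finset.Icc 1 n).filter (IsParkingFunction n)

theorem mem_parkingFunctions {n : ℕ} {p : Fin n → ℕ} :
    p ∈ parkingFunctions n ↔ IsParkingFunction n p := by
  classical
  simp only [parkingFunctions, Finset.mem_filter, Fintype.mem_piFinset, Finset.mem_Icc]
  exact ⟨fun h => h.2, fun h => ⟨h.1, h⟩⟩

/-- The area statistic `n (n + 1) / 2 - (p_1 + ⋯ + p_n)`. -/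
noncomputable def parkingArea {n : ℕ} (p : Fin n → ℕ) : ℝ :=
  (n : ℝ) * ((n : ℝ) + 1) / 2 - ∑ i, (p i : ℝ)

/-- The expectation of the statistic `f` for a uniformly random parking function of length `n`. -/
noncomputable def parkingExpectation (n : ℕ) (f : (Fin n → ℕ) → ℝ) : ℝ :=
  (∑ p ∈ parkingFunctions n, f p) / ((parkingFunctions n).card : ℝ)

/-- The `k`-th factorial moment of area: the expectation of
`area * (area - 1) * ⋯ * (area - k + 1)`. -/
noncomputable def areaFactorialMoment (k n : ℕ) : ℝ :=
  parkingExpectation n fun p => ∏ j ∈ Finset.range k, (parkingArea p - (j : ℝ))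

/-- The expectation `E₁(n)` of area. -/
noncomputable def areaExpectation (n : ℕ) : ℝ :=
  parkingExpectation n fun p => parkingArea p

/-! Shifting values by one turns a parking function into a queue with one initial customer that
stays busy until everybody is served, and area plus `n` becomes total waiting time. Sorting such
queues by the set of customers arriving at time zero gives `busySum_succ`, a recurrence for the
exponential generating functions `F_a` with `a` initial customers. It has a unique solution, so both
`F_{a+1}(z) = q^a F_1(z) F_a(qz)` and `(q - 1) F_a' = q (F_{a+1} - F_1 F_a)` follow by checking that
the difference of the two sides satisfies a homogeneous recurrence of the same kind. Taking `a = 1`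
gives a quadratic recursion for the area enumerators, `sub_one_mul_parkingSum_succ`.

Putting `q = 1 + t` and comparing powers of `t` yields differential equations for the series `W_r`
of binomial moments of area (`solvesAreaEquation_areaSeries`). For `r = 0`, `T = X * W_0` is the
tree function. With `Y = 1/(1 - T)`, the ansatz `W_r = W_0 * V_r(Y - 1)` reduces the equations to
polynomial identities, which are checked for explicit `V_0, ..., V_5`. Then `X * W_5` is a
polynomial in `Y` plus a multiple of `1 - T`. Since `X Y' = Y^2 (Y - 1)`, the coefficients of higher
powers of `Y` reduce to those of `Y` and `Y^2`, that is, to `W_0` and `W_1`; dividing by the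
coefficient of `W_0` gives the exact formula. The sum for `E₁` comes from the coefficients of `Y`
and `Y^2`.

For the asymptotics, `E₁` is expressed through Ramanujan's `Q`. Pairing the terms of the exponential
series around its peak shows that `2 Q(N)` is within a constant of `N! e^N / N^N`, and Stirling's
formula gives `E₁(n) = √(2π)/4 * n^(3/2) + O(n)`. -/

/-! ### Busy queues and their waiting-time enumerator -/

open Finset in
/-- `f` describes a queue that starts with `a` customers, is joined by customer `i` at time `f i`,
serves one customer per time unit, and does not become empty before everybody was served. -/
def IsBusy {ι : Type*} [Fintype ι] (a : ℕ) (f : ι → ℕ) : Prop :=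
  ∀ j < Fintype.card ι + a, j < #{i | f i < j} + a

theorem IsBusy.lt {ι : Type*} [Fintype ι] {a : ℕ} {f : ι → ℕ} (h : IsBusy a f) (i : ι) :
    f i + 1 < Fintype.card ι + a := by
  have hpos : 0 < Fintype.card ι := Fintype.card_pos_iff.2 ⟨i⟩
  have h1 := h (Fintype.card ι + a - 1) (by omega)
  have h2 : (Finset.univ.filter fun i => f i < Fintype.card ι + a - 1).card
      = (Finset.univ : Finset ι).card := by
    have := Finset.card_le_univ (Finset.univ.filter fun i => f i < Fintype.card ι + a - 1)
    rw [Finset.card_univ]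
    omega
  have h3 := (Finset.card_eq_iff_eq_univ _).1 (h2.trans Finset.card_univ)
  have h4 : i ∈ Finset.univ.filter fun i => f i < Fintype.card ι + a - 1 := by
    rw [h3]; exact Finset.mem_univ i
  have := (Finset.mem_filter.1 h4).2
  omega

/-- Layer-cake count: at most `card ι + a - 1 - j` customers arrive after time `j`, and these bounds
sum to the binomial coefficient. Hence the truncated subtraction in `busySum` is a true one. -/
theorem IsBusy.sum_le {ι : Type*} [Fintype ι] {a : ℕ} {f : ι → ℕ} (h : IsBusy a f) :
    ∑ i, f i ≤ (Fintype.card ι + a).choose 2 := by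
  have h1 : ∀ i, f i = ∑ j ∈ Finset.range (Fintype.card ι + a), if j < f i then 1 else 0 := by
    intro i
    rw [← Finset.card_filter]
    have : (Finset.range (Fintype.card ι + a)).filter (fun j => j < f i) = Finset.range (f i) := by
      ext j
      simp only [Finset.mem_filter, Finset.mem_range]
      have := h.lt i
      omega
    rw [this, Finset.card_range]
  rw [Finset.sum_congr rfl fun i _ => h1 i, Finset.sum_comm, Nat.choose_two_right,
    ← Finset.sum_range_id, ← Finset.sum_range_reflect (fun j => j)]
  refine Finset.sum_le_sum fun j hj => ?_
  rw [← Finset.card_filter]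
  have h2 := h j (Finset.mem_range.1 hj)
  have h3 := Finset.card_filter_add_card_filter_not (s := (Finset.univ : Finset ι))
    (fun i => f i < j)
  have h4 : (Finset.univ.filter fun i => j < f i).card
      ≤ (Finset.univ.filter fun i => ¬ f i < j).card :=
    Finset.card_le_card fun i hi => by
      simp only [Finset.mem_filter, Finset.mem_univ, true_and] at hi ⊢
      omega
  rw [Finset.card_univ] at h3
  omega

open Classical in
/-- The finite set of all arrival functions satisfying `IsBusy a`. -/
noncomputable def busyFunctions (ι : Type*) [Fintype ι] (a : ℕ) : Finset (ι → ℕ) :=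
  (Fintype.piFinset fun _ : ι => Finset.range (Fintype.card ι + a)).filter (IsBusy a)

theorem mem_busyFunctions {ι : Type*} [Fintype ι] {a : ℕ} {f : ι → ℕ} :
    f ∈ busyFunctions ι a ↔ IsBusy a f := by
  classical
  simp only [busyFunctions, Finset.mem_filter, Fintype.mem_piFinset, Finset.mem_range]
  exact ⟨fun h => h.2, fun h => ⟨fun i => (Nat.lt_succ_self _).trans (h.lt i), h⟩⟩

/-- The generating function of the total waiting time over all `IsBusy a` arrival functions. -/
noncomputable def busySum {R : Type*} [CommSemiring R] (q : R) (ι : Type*) [Fintype ι] (a : ℕ) :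
    R :=
  ∑ f ∈ busyFunctions ι a, q ^ ((Fintype.card ι + a).choose 2 - ∑ i, f i)

theorem IsBusy.comp_equiv {ι κ : Type*} [Fintype ι] [Fintype κ] (e : ι ≃ κ) {a : ℕ} {f : κ → ℕ}
    (h : IsBusy a f) : IsBusy a (f ∘ e) := by
  intro j hj
  rw [Fintype.card_congr e] at hj
  refine (h j hj).trans_eq ?_
  congr 1
  rw [Finset.card_filter, Finset.card_filter]
  exact (Equiv.sum_comp e fun k => if f k < j then 1 else 0).symm

theorem busySum_congr {R : Type*} [CommSemiring R] (q : R) {ι κ : Type*} [Fintype ι] [Fintype κ]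
    (e : ι ≃ κ) (a : ℕ) : busySum q ι a = busySum q κ a := by
  refine Finset.sum_bij' (fun f _ => f ∘ e.symm) (fun f _ => f ∘ e) ?_ ?_ ?_ ?_ ?_
  · exact fun f hf => mem_busyFunctions.2 ((mem_busyFunctions.1 hf).comp_equiv e.symm)
  · exact fun f hf => mem_busyFunctions.2 ((mem_busyFunctions.1 hf).comp_equiv e)
  · exact fun f _ => by ext i; simp
  · exact fun f _ => by ext i; simp
  · intro f _
    rw [Fintype.card_congr e]
    congr 2
    exact (Equiv.sum_comp e.symm f).symm

theorem busySum_zero {R : Type*} [CommSemiring R] (q : R) (n : ℕ) :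
    busySum q (Fin n) 0 = if n = 0 then 1 else 0 := by
  rcases Nat.eq_zero_or_pos n with rfl | hn
  · have : busyFunctions (Fin 0) 0 = {Fin.elim0} := by
      ext f
      simp only [mem_busyFunctions, Finset.mem_singleton]
      exact ⟨fun _ => Subsingleton.elim _ _, fun _ j hj => by simp at hj⟩
    simp [busySum, this]
  · have : busyFunctions (Fin n) 0 = ∅ := by
      refine Finset.eq_empty_of_forall_notMem fun f hf => ?_
      have := mem_busyFunctions.1 hf 0 (by simpa using hn)
      simp at this
    simp [busySum, this, hn.ne']

/-- Let the customers in `S` arrive at time zero, and delay all others by one time unit. -/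
def delayOutside {ι : Type*} [DecidableEq ι] (S : Finset ι) (g : {i // i ∉ S} → ℕ) (i : ι) : ℕ :=
  if h : i ∈ S then 0 else g ⟨i, h⟩ + 1

theorem sum_eq_sum_add_sum_notMem {ι : Type*} [Fintype ι] [DecidableEq ι] (S : Finset ι)
    (f : ι → ℕ) : ∑ i, f i = ∑ i ∈ S, f i + ∑ i : {i // i ∉ S}, f i := by
  rw [← Finset.sum_add_sum_compl S f]
  congr 1
  exact Finset.sum_subtype _ (by simp) f

theorem card_notMem_add {ι : Type*} [Fintype ι] [DecidableEq ι] (S : Finset ι) :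
    Fintype.card {i // i ∉ S} + S.card = Fintype.card ι := by
  have := sum_eq_sum_add_sum_notMem S fun _ => 1
  simp only [Finset.sum_const, smul_eq_mul, mul_one, Finset.card_univ] at this
  omega

theorem sum_delayOutside {ι : Type*} [Fintype ι] [DecidableEq ι] (S : Finset ι)
    (g : {i // i ∉ S} → ℕ) :
    ∑ i, delayOutside S g i = ∑ i, g i + Fintype.card {i // i ∉ S} := by
  rw [sum_eq_sum_add_sum_notMem S, Finset.sum_eq_zero fun i hi => by simp [delayOutside, hi],
    zero_add, Finset.sum_congr rfl (g := fun i => g i + 1)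
      fun i _ => by simp [delayOutside, i.2], Finset.sum_add_distrib]
  simp [Finset.card_univ]

theorem card_delayOutside_lt {ι : Type*} [Fintype ι] [DecidableEq ι] (S : Finset ι)
    (g : {i // i ∉ S} → ℕ) (j : ℕ) :
    (Finset.univ.filter fun i => delayOutside S g i < j + 1).card
      = S.card + (Finset.univ.filter fun i => g i < j).card := by
  rw [Finset.card_filter, Finset.card_filter, sum_eq_sum_add_sum_notMem S]
  congr 1
  · rw [Finset.card_eq_sum_ones]
    exact Finset.sum_congr rfl fun i hi => by simp [delayOutside, hi]
  · exact Finset.sum_congr rfl fun i _ => by simp [delayOutside, i.2]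

/-- After one time unit one customer has left and those of `S` have joined, so the condition at time
`j + 1` becomes the condition at time `j` for the remaining queue. The condition at time zero is
automatic. -/
theorem isBusy_delayOutside {ι : Type*} [Fintype ι] [DecidableEq ι] (S : Finset ι)
    (g : {i // i ∉ S} → ℕ) (a : ℕ) :
    IsBusy (a + 1) (delayOutside S g) ↔ IsBusy (a + S.card) g := by
  have hc := card_notMem_add S
  constructor
  · intro h j hj
    have := h (j + 1) (by omega)
    rw [card_delayOutside_lt] at this
    omega
  · intro h j hj
    rcases j with _ | j
    · omega
    · have := h j (by omega)
      rw [card_delayOutside_lt]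
      omega

/-- Here `S` is the set of arrivals at time zero. During the first time unit one customer is served
and the other `a + S.card` present wait, which explains the power of `q`. -/
theorem busySum_succ_eq_sum_finset {R : Type*} [CommSemiring R] (q : R) (ι : Type*) [Fintype ι]
    [DecidableEq ι] (a : ℕ) :
    busySum q ι (a + 1)
      = ∑ S : Finset ι, q ^ (a + S.card) * busySum q {i // i ∉ S} (a + S.card) := by
  classical
  rw [busySum, ← Finset.sum_fiberwise _ fun f : ι → ℕ => Finset.univ.filter fun i => f i = 0]
  refine Finset.sum_congr rfl fun S _ => ?_
  rw [busySum, Finset.mul_sum]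
  have hc := card_notMem_add S
  have hd : ∀ f : ι → ℕ, (Finset.univ.filter fun i => f i = 0) = S →
      delayOutside S (fun i => f i - 1) = f := by
    intro f hf
    ext i
    have hi : i ∈ S ↔ f i = 0 := by rw [← hf]; simp
    by_cases h : i ∈ S
    · simp [delayOutside, h, hi.1 h]
    · have : f i ≠ 0 := fun h' => h (hi.2 h')
      simp only [delayOutside, h, dite_false]
      omega
  refine Finset.sum_bij' (fun f _ i => f i - 1) (fun g _ => delayOutside S g) ?_ ?_ ?_ ?_ ?_
  · intro f hf
    obtain ⟨h1, h2⟩ := Finset.mem_filter.1 hf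
    rw [mem_busyFunctions, ← isBusy_delayOutside, hd f h2]
    exact mem_busyFunctions.1 h1
  · intro g hg
    refine Finset.mem_filter.2 ⟨mem_busyFunctions.2
      ((isBusy_delayOutside S g a).2 (mem_busyFunctions.1 hg)), ?_⟩
    ext i
    by_cases h : i ∈ S <;> simp [delayOutside, h]
  · exact fun f hf => hd f (Finset.mem_filter.1 hf).2
  · intro g _
    ext i
    simp [delayOutside, i.2]
  · intro f hf
    obtain ⟨h1, h2⟩ := Finset.mem_filter.1 hf
    have h3 : IsBusy (a + S.card) fun i : {i // i ∉ S} => f i - 1 := by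
      rw [← isBusy_delayOutside, hd f h2]
      exact mem_busyFunctions.1 h1
    have h4 : ∑ i : {i // i ∉ S}, (f i - 1) ≤ _ := h3.sum_le
    have h5 := sum_delayOutside S fun i => f i - 1
    rw [hd f h2] at h5
    rw [← pow_add, h5]
    have h6 : Fintype.card ι + (a + 1) = Fintype.card {i // i ∉ S} + (a + S.card) + 1 := by omega
    have h7 : ∀ m : ℕ, (m + 1).choose 2 = m + m.choose 2 := fun m => by
      rw [Nat.choose_succ_succ' _ 1, Nat.choose_one_right]
    rw [h6, h7]
    congr 1
    beta_reduce
    omega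

theorem busySum_succ {R : Type*} [CommSemiring R] (q : R) (n a : ℕ) :
    busySum q (Fin n) (a + 1) = ∑ k ∈ Finset.range (n + 1),
      (n.choose k : R) * (q ^ (a + k) * busySum q (Fin (n - k)) (a + k)) := by
  rw [busySum_succ_eq_sum_finset, ← Finset.powerset_univ]
  have h : ∀ S : Finset (Fin n), q ^ (a + S.card) * busySum q {i // i ∉ S} (a + S.card)
      = (fun k => q ^ (a + k) * busySum q (Fin (n - k)) (a + k)) S.card := by
    intro S
    have hc := card_notMem_add S
    rw [Fintype.card_fin] at hc
    rw [busySum_congr q (Fintype.equivFinOfCardEq (n := n - S.card) (by omega))]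
  rw [Finset.sum_congr rfl fun S _ => h S, Finset.sum_powerset_apply_card
    fun k => q ^ (a + k) * busySum q (Fin (n - k)) (a + k)]
  simp [nsmul_eq_mul]

/-! ### Parking functions as busy queues -/

theorem card_filter_comp_sort {n : ℕ} (p : Fin n → ℕ) (j : ℕ) :
    (Finset.univ.filter fun i => (p ∘ Tuple.sort p) i ≤ j).card
      = (Finset.univ.filter fun i => p i ≤ j).card := by
  rw [Finset.card_filter, Finset.card_filter]
  exact Equiv.sum_comp (Tuple.sort p) fun i => if p i ≤ j then 1 else 0

/-- The counts on the right do not change under sorting, and for a sorted vector they say exactly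
where each value may lie. -/
theorem forall_sort_le_iff {n : ℕ} (p : Fin n → ℕ) :
    (∀ i : Fin n, (p ∘ Tuple.sort p) i ≤ (i : ℕ) + 1) ↔
      ∀ j ≤ n, j ≤ (Finset.univ.filter fun i => p i ≤ j).card := by
  constructor
  · intro h j hj
    rw [← card_filter_comp_sort]
    calc j = (Finset.univ.filter fun i : Fin n => (i : ℕ) < j).card := by
          rw [Fin.card_filter_val_lt, min_eq_right hj]
      _ ≤ _ := Finset.card_le_card fun i hi => by
          simp only [Finset.mem_filter, Finset.mem_univ, true_and] at hi ⊢
          exact (h i).trans hi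
  · intro h i
    by_contra! hlt
    have h1 := h (i + 1) i.2
    rw [← card_filter_comp_sort] at h1
    have h2 : (Finset.univ.filter fun k => (p ∘ Tuple.sort p) k ≤ (i : ℕ) + 1).card
        ≤ (Finset.univ.filter fun k : Fin n => (k : ℕ) < i).card :=
      Finset.card_le_card fun k hk => by
        simp only [Finset.mem_filter, Finset.mem_univ, true_and] at hk ⊢
        by_contra! hik
        have := Tuple.monotone_sort p (show i ≤ k from hik)
        omega
    rw [Fin.card_filter_val_lt] at h2
    omega

theorem isParkingFunction_iff_isBusy {n : ℕ} (p : Fin n → ℕ) :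
    IsParkingFunction n p ↔ (∀ i, 1 ≤ p i) ∧ IsBusy 1 fun i => p i - 1 := by
  rw [IsParkingFunction, forall_sort_le_iff]
  have hset : (∀ i, 1 ≤ p i) → ∀ j, (Finset.univ.filter fun i => p i - 1 < j)
      = Finset.univ.filter fun i => p i ≤ j := by
    intro h j
    ext i
    have := h i
    simp only [Finset.mem_filter, Finset.mem_univ, true_and]
    omega
  constructor
  · rintro ⟨h1, h2⟩
    refine ⟨fun i => (h1 i).1, fun j hj => ?_⟩
    rw [Fintype.card_fin] at hj
    have := h2 j (by omega)
    rw [hset fun i => (h1 i).1]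
    omega
  · rintro ⟨h1, h2⟩
    refine ⟨fun i => ⟨h1 i, ?_⟩, fun j hj => ?_⟩
    · have : p i - 1 + 1 < Fintype.card (Fin n) + 1 := h2.lt i
      rw [Fintype.card_fin] at this
      omega
    · have := h2 j (by rw [Fintype.card_fin]; omega)
      rw [hset h1] at this
      omega

/-- The area of a parking function as a natural number. -/
def parkingAreaNat {n : ℕ} (p : Fin n → ℕ) : ℕ := (n + 1).choose 2 - ∑ i, p i

theorem IsParkingFunction.sum_le {n : ℕ} {p : Fin n → ℕ} (h : IsParkingFunction n p) :
    ∑ i, p i ≤ (n + 1).choose 2 := by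
  have h1 : ∑ i, p i = ∑ i, (p ∘ Tuple.sort p) i := (Equiv.sum_comp (Tuple.sort p) p).symm
  rw [h1, Nat.choose_two_right, ← Finset.sum_range_id, Finset.sum_range_succ', add_zero,
    ← Fin.sum_univ_eq_sum_range fun i => i + 1]
  exact Finset.sum_le_sum fun i _ => h.2 i

theorem IsParkingFunction.cast_parkingAreaNat {n : ℕ} {p : Fin n → ℕ}
    (h : IsParkingFunction n p) : (parkingAreaNat p : ℝ) = parkingArea p := by
  rw [parkingAreaNat, parkingArea, Nat.cast_sub h.sum_le, Nat.cast_choose_two]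
  push_cast
  ring

/-- The area enumerator of parking functions of length `n`. -/
noncomputable def parkingSum {R : Type*} [CommSemiring R] (q : R) (n : ℕ) : R :=
  ∑ p ∈ parkingFunctions n, q ^ parkingAreaNat p

/-- Lowering all `n` entries by one raises the exponent by `n`. -/
theorem busySum_one {R : Type*} [CommSemiring R] (q : R) (n : ℕ) :
    busySum q (Fin n) 1 = q ^ n * parkingSum q n := by
  rw [parkingSum, Finset.mul_sum]
  symm
  refine Finset.sum_bij' (fun p _ i => p i - 1) (fun f _ i => f i + 1) ?_ ?_ ?_ ?_ ?_
  · exact fun p hp => mem_busyFunctions.2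
      ((isParkingFunction_iff_isBusy p).1 (mem_parkingFunctions.1 hp)).2
  · exact fun f hf => mem_parkingFunctions.2
      ((isParkingFunction_iff_isBusy _).2 ⟨fun i => by omega, mem_busyFunctions.1 hf⟩)
  · intro p hp
    ext i
    exact Nat.sub_add_cancel ((mem_parkingFunctions.1 hp).1 i).1
  · exact fun f _ => rfl
  · intro p hp
    have hp' := mem_parkingFunctions.1 hp
    have h1 : ∑ i, p i = ∑ i, (p i - 1) + n := by
      rw [Finset.sum_congr rfl fun i _ => (Nat.sub_add_cancel (hp'.1 i).1).symm,
        Finset.sum_add_distrib]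
      simp
    have h2 := hp'.sum_le
    rw [← pow_add, parkingAreaNat, Fintype.card_fin]
    congr 1
    beta_reduce
    omega

/-! ### Generating functions and the quadratic recursion -/

open PowerSeries in
/-- The power series `∑ X ^ k / k! * G k`. -/
noncomputable def expSum {R : Type*} [CommRing R] [Algebra ℚ R] (G : ℕ → R⟦X⟧) : R⟦X⟧ :=
  PowerSeries.mk fun n => ∑ k ∈ Finset.range (n + 1),
    algebraMap ℚ R (1 / k.factorial) * coeff (n - k) (G k)

open PowerSeries in
theorem rescale_const {R : Type*} [CommRing R] (q r : R) : rescale q (C r) = C r := by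
  ext n
  rw [coeff_rescale, coeff_C]
  split_ifs with h <;> simp [h]

section expSum

open PowerSeries

variable {R : Type*} [CommRing R] [Algebra ℚ R]

theorem coeff_expSum (G : ℕ → R⟦X⟧) (n : ℕ) :
    coeff n (expSum G) = ∑ k ∈ Finset.range (n + 1),
      algebraMap ℚ R (1 / k.factorial) * coeff (n - k) (G k) := coeff_mk _ _

/-- Terms with `k > n` are divisible by `X ^ (n + 1)`, so identities for `expSum` can be proved on
finite truncations. -/
theorem coeff_expSum_eq_coeff_sum (G : ℕ → R⟦X⟧) {n N : ℕ} (h : n < N) :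
    coeff n (expSum G) = coeff n (∑ k ∈ Finset.range N,
      C (algebraMap ℚ R (1 / k.factorial)) * (X ^ k * G k)) := by
  rw [coeff_expSum, map_sum]
  have hs : Finset.range (n + 1) ⊆ Finset.range N := Finset.range_subset_range.2 h
  rw [← Finset.sum_subset hs]
  · refine Finset.sum_congr rfl fun k hk => ?_
    rw [coeff_C_mul, coeff_X_pow_mul', if_pos (by have := Finset.mem_range.1 hk; omega)]
  · intro k _ hk
    rw [coeff_C_mul, coeff_X_pow_mul', if_neg (by rw [Finset.mem_range] at hk; omega), mul_zero]

theorem mul_expSum (H : R⟦X⟧) (G : ℕ → R⟦X⟧) :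
    H * expSum G = expSum fun k => H * G k := by
  ext n
  rw [coeff_expSum_eq_coeff_sum _ n.lt_succ_self]
  have : ∑ k ∈ Finset.range (n + 1), C (algebraMap ℚ R (1 / k.factorial)) * (X ^ k * (H * G k))
      = H * ∑ k ∈ Finset.range (n + 1), C (algebraMap ℚ R (1 / k.factorial)) * (X ^ k * G k) := by
    rw [Finset.mul_sum]
    exact Finset.sum_congr rfl fun k _ => by ring
  rw [this, coeff_mul, coeff_mul]
  refine Finset.sum_congr rfl fun p hp => ?_
  rw [coeff_expSum_eq_coeff_sum G (N := n + 1)]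
  have := Finset.HasAntidiagonal.mem_antidiagonal.1 hp
  omega

theorem expSum_sub (G H : ℕ → R⟦X⟧) : expSum (fun k => G k - H k) = expSum G - expSum H := by
  ext n
  simp only [map_sub, coeff_expSum, mul_sub, Finset.sum_sub_distrib]

theorem expSum_add (G H : ℕ → R⟦X⟧) : expSum (fun k => G k + H k) = expSum G + expSum H := by
  ext n
  simp only [map_add, coeff_expSum, mul_add, Finset.sum_add_distrib]

theorem rescale_expSum (q : R) (G : ℕ → R⟦X⟧) :
    rescale q (expSum G) = expSum fun k => C (q ^ k) * rescale q (G k) := by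
  ext n
  rw [coeff_rescale, coeff_expSum, coeff_expSum, Finset.mul_sum]
  refine Finset.sum_congr rfl fun k hk => ?_
  rw [coeff_C_mul, coeff_rescale]
  have : q ^ n = q ^ k * q ^ (n - k) := by
    rw [← pow_add]; congr 1; have := Finset.mem_range.1 hk; omega
  rw [this]
  ring

theorem derivative_expSum (G : ℕ → R⟦X⟧) :
    d⁄dX R (expSum G) = expSum (fun k => G (k + 1)) + expSum fun k => d⁄dX R (G k) := by
  ext n
  rw [coeff_derivative, coeff_expSum_eq_coeff_sum G (n + 1).lt_succ_self, ← coeff_derivative,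
    map_add, coeff_expSum_eq_coeff_sum _ n.lt_succ_self,
    coeff_expSum_eq_coeff_sum _ (n.lt_succ_self.trans (n + 1).lt_succ_self), ← map_add]
  congr 1
  have h : ∀ k : ℕ, d⁄dX R (C (algebraMap ℚ R (1 / k.factorial)) * (X ^ k * G k))
      = C (algebraMap ℚ R (1 / k.factorial)) * ((k : R⟦X⟧) * X ^ (k - 1) * G k)
        + C (algebraMap ℚ R (1 / k.factorial)) * (X ^ k * d⁄dX R (G k)) := by
    intro k
    simp only [Derivation.leibniz, derivative_C, smul_eq_mul, derivative_pow, derivative_X]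
    ring
  rw [map_sum, Finset.sum_congr rfl fun k _ => h k, Finset.sum_add_distrib,
    Finset.sum_range_succ']
  simp only [Nat.cast_zero, zero_mul, mul_zero, add_zero]
  congr 1
  refine Finset.sum_congr rfl fun k _ => ?_
  have : algebraMap ℚ R (1 / k.factorial)
      = algebraMap ℚ R (1 / (k + 1).factorial) * (k + 1 : ℕ) := by
    rw [← map_natCast (algebraMap ℚ R), ← map_mul]
    congr 1
    rw [Nat.factorial_succ]
    push_cast
    have : (k.factorial : ℚ) ≠ 0 := by positivity
    field_simp
  rw [this, map_mul, map_natCast, Nat.add_sub_cancel]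
  ring

/-- In the coefficient of order `n`, the term `k = 0` lowers `a` and every other term lowers `n`.
This is the uniqueness principle behind the two functional equations for `busySeries`. -/
theorem eq_zero_of_expSum_recurrence (c : ℕ → ℕ → R) (G : ℕ → R⟦X⟧) (h0 : G 0 = 0)
    (h : ∀ a, G (a + 1) = expSum fun k => C (c a k) * G (a + k)) (a : ℕ) : G a = 0 := by
  suffices H : ∀ n a, coeff n (G a) = 0 by
    ext n; simp [H]
  intro n
  induction n using Nat.strong_induction_on with
  | _ n ihn =>
    intro a
    induction a with
    | zero => simp [h0]
    | succ a iha =>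
      rw [h, coeff_expSum]
      refine Finset.sum_eq_zero fun k hk => ?_
      rw [coeff_C_mul]
      rcases Nat.eq_zero_or_pos k with rfl | hk0
      · simp [iha]
      · rw [ihn (n - k) (by have := Finset.mem_range.1 hk; omega), mul_zero, mul_zero]

/-- The exponential generating function of `busySum q (Fin n) a`. -/
noncomputable def busySeries (q : R) (a : ℕ) : R⟦X⟧ :=
  PowerSeries.mk fun n => algebraMap ℚ R (1 / n.factorial) * busySum q (Fin n) a

theorem busySeries_zero (q : R) : busySeries q 0 = 1 := by
  ext n
  rw [busySeries, coeff_mk, busySum_zero, coeff_one]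
  split_ifs with h <;> simp [h]

theorem busySeries_succ (q : R) (a : ℕ) :
    busySeries q (a + 1) = expSum fun k => C (q ^ (a + k)) * busySeries q (a + k) := by
  ext n
  rw [busySeries, coeff_mk, busySum_succ, coeff_expSum, Finset.mul_sum]
  refine Finset.sum_congr rfl fun k hk => ?_
  rw [coeff_C_mul, busySeries, coeff_mk]
  have hk : k ≤ n := by have := Finset.mem_range.1 hk; omega
  have : algebraMap ℚ R (1 / n.factorial) * (n.choose k : R)
      = algebraMap ℚ R (1 / k.factorial) * algebraMap ℚ R (1 / (n - k).factorial) := by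
    rw [← map_natCast (algebraMap ℚ R), ← map_mul, ← map_mul, Nat.cast_choose ℚ hk]
    congr 1
    have : (n.factorial : ℚ) ≠ 0 := by positivity
    field_simp
  linear_combination (q ^ (a + k) * busySum q (Fin (n - k)) (a + k)) * this

/-- Rescaling by `q` contributes the factor `q ^ k` to the `k`-th term of `expSum`, just what the
shift of `a` requires; so the difference of the two sides obeys a linear recurrence and vanishes at
`a = 0`. -/
theorem busySeries_succ_eq_mul_rescale (q : R) (a : ℕ) :
    busySeries q (a + 1)
      = C (q ^ a) * (busySeries q 1 * rescale q (busySeries q a)) := by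
  rw [← sub_eq_zero]
  refine eq_zero_of_expSum_recurrence (fun a k => q ^ (a + 1 + k))
    (fun a => busySeries q (a + 1) - C (q ^ a) * (busySeries q 1 * rescale q (busySeries q a)))
    ?_ ?_ a
  · simp [busySeries_zero]
  · intro a
    simp only [mul_sub]
    rw [expSum_sub]
    congr 1
    · rw [busySeries_succ]
      congr 1
      ext1 k
      rw [add_right_comm]
    · rw [busySeries_succ q a, rescale_expSum, mul_expSum, mul_expSum]
      congr 1
      ext1 k
      simp only [map_mul, rescale_const, ← mul_assoc, map_pow]
      ring

theorem derivative_busySeries (q : R) (a : ℕ) :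
    C (q - 1) * d⁄dX R (busySeries q a)
      = C q * (busySeries q (a + 1) - busySeries q 1 * busySeries q a) := by
  rw [← sub_eq_zero]
  refine eq_zero_of_expSum_recurrence (fun a k => q ^ (a + k))
    (fun a => C (q - 1) * d⁄dX R (busySeries q a)
      - C q * (busySeries q (a + 1) - busySeries q 1 * busySeries q a)) ?_ ?_ a
  · simp [busySeries_zero]
  · intro a
    have h1 := busySeries_succ q a
    have h2 : busySeries q (a + 1 + 1)
      = expSum fun k => C (q ^ (a + k + 1)) * busySeries q (a + k + 1) := by
      rw [busySeries_succ]
      congr 1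
      ext1 k
      rw [add_right_comm]
    have h3 : d⁄dX R (busySeries q (a + 1)) = busySeries q (a + 1 + 1)
        + expSum fun k => C (q ^ (a + k)) * d⁄dX R (busySeries q (a + k)) := by
      rw [h2]
      conv_lhs => rw [h1]
      rw [derivative_expSum]
      congr 1
      congr 1
      ext1 k
      simp [Derivation.leibniz]
    have h4 : (fun k => C (q ^ (a + k)) * (C (q - 1) * d⁄dX R (busySeries q (a + k))
        - C q * (busySeries q (a + k + 1) - busySeries q 1 * busySeries q (a + k))))
      = fun k => (C (q - 1) * (C (q ^ (a + k)) * d⁄dX R (busySeries q (a + k)))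
        - C (q ^ (a + k + 1)) * busySeries q (a + k + 1))
        + C q * busySeries q 1 * (C (q ^ (a + k)) * busySeries q (a + k)) := by
      ext1 k
      simp only [map_pow]
      ring
    rw [h4, expSum_add, expSum_sub, ← mul_expSum, ← mul_expSum, ← h1, ← h2, h3, map_sub, map_one]
    ring

end expSum

/-- Eliminating `busySeries q 2` between the two functional equations leaves an equation in
`busySeries q 1` alone. By `busySum_one` its coefficients carry a common power of `q`, which is
cancelled. -/
theorem sub_one_mul_parkingSum_succ {R : Type*} [CommRing R] [IsDomain R] [Algebra ℚ R] {q : R}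
    (hq : q ≠ 0) (n : ℕ) :
    (q - 1) * (algebraMap ℚ R (1 / n.factorial) * parkingSum q (n + 1))
      = ∑ p ∈ Finset.HasAntidiagonal.antidiagonal n,
        algebraMap ℚ R (1 / p.1.factorial) * parkingSum q p.1 *
         ((q ^ (p.2 + 1) - 1) * (algebraMap ℚ R (1 / p.2.factorial) * parkingSum q p.2)) := by
  open PowerSeries in
  have h := derivative_busySeries q 1
  rw [busySeries_succ_eq_mul_rescale q 1, pow_one] at h
  have h1 : (C (q - 1) : R⟦X⟧) * d⁄dX R (busySeries q 1)
      = C q * (busySeries q 1 * (C q * rescale q (busySeries q 1) - busySeries q 1)) := by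
    rw [h]; ring
  have h2 := congrArg (coeff n) h1
  rw [coeff_C_mul, coeff_C_mul, coeff_derivative, coeff_mul] at h2
  simp only [map_sub, coeff_C_mul, coeff_rescale, busySeries, coeff_mk, busySum_one] at h2
  refine mul_left_cancel₀ (pow_ne_zero (n + 1) hq) ?_
  have h3 : algebraMap ℚ R (1 / n.factorial)
      = algebraMap ℚ R (1 / (n + 1).factorial) * (n + 1) := by
    have : algebraMap ℚ R (n + 1) = (n : R) + 1 := by simp
    rw [← this, ← map_mul]
    congr 1
    rw [Nat.factorial_succ]
    push_cast
    have : (n.factorial : ℚ) ≠ 0 := by positivity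
    field_simp
  rw [h3]
  refine Eq.trans ?_ (h2.trans ?_)
  · ring
  · rw [Finset.mul_sum, Finset.mul_sum]
    refine Finset.sum_congr rfl fun p hp => ?_
    rw [← Finset.HasAntidiagonal.mem_antidiagonal.1 hp]
    ring

/-! ### Differential equations for the binomial moments -/

section AreaSystem

open PowerSeries Finset.HasAntidiagonal

/-- The power series whose `k`-th coefficient is that of `f` times `(k + 1).choose (j + 1)`. -/
noncomputable def chooseMul (j : ℕ) (f : ℚ⟦X⟧) : ℚ⟦X⟧ :=
  PowerSeries.mk fun k => ((k + 1).choose (j + 1) : ℚ) * coeff k f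

theorem coeff_chooseMul (j k : ℕ) (f : ℚ⟦X⟧) :
    coeff k (chooseMul j f) = ((k + 1).choose (j + 1) : ℚ) * coeff k f := coeff_mk _ _

/-- The differential equation for the binomial moments of area of order `r`. -/
def SolvesAreaEquation (W : ℕ → ℚ⟦X⟧) (r : ℕ) : Prop :=
  d⁄dX ℚ (W r) = ∑ x ∈ antidiagonal r, W x.1 * ∑ y ∈ antidiagonal x.2, chooseMul y.1 (W y.2)

/-- The derivative on the left expresses the coefficient of order `n + 1` through coefficients of
order at most `n`, for moments of order at most `r`. -/
theorem SolvesAreaEquation.unique {V W : ℕ → ℚ⟦X⟧} {R : ℕ}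
    (hV : ∀ r ≤ R, SolvesAreaEquation V r) (hW : ∀ r ≤ R, SolvesAreaEquation W r)
    (h0 : ∀ r ≤ R, coeff 0 (V r) = coeff 0 (W r)) {r : ℕ} (hr : r ≤ R) : V r = W r := by
  suffices H : ∀ n, ∀ r ≤ R, coeff n (V r) = coeff n (W r) by
    ext n; exact H n r hr
  intro n
  induction n using Nat.strong_induction_on with
  | _ n ih =>
    rcases n with _ | n
    · exact h0
    intro r hr
    have hn : (n : ℚ) + 1 ≠ 0 := by positivity
    refine mul_right_cancel₀ hn ?_
    rw [← coeff_derivative, ← coeff_derivative, hV r hr, hW r hr, map_sum, map_sum]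
    refine Finset.sum_congr rfl fun x hx => ?_
    have hx' := mem_antidiagonal.1 hx
    rw [coeff_mul, coeff_mul]
    refine Finset.sum_congr rfl fun p hp => ?_
    have hp' := mem_antidiagonal.1 hp
    rw [ih p.1 (by omega) x.1 (by omega), map_sum, map_sum]
    congr 1
    refine Finset.sum_congr rfl fun y hy => ?_
    have hy' := mem_antidiagonal.1 hy
    rw [coeff_chooseMul, coeff_chooseMul, ih p.2 (by omega) y.2 (by omega)]

/-- The exponential generating function of the sums of `area.choose r` over parking functions. -/
noncomputable def areaSeries (r : ℕ) : ℚ⟦X⟧ :=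
  PowerSeries.mk fun n =>
    1 / n.factorial * ∑ p ∈ parkingFunctions n, ((parkingAreaNat p).choose r : ℚ)

theorem coeff_parkingSum (r n : ℕ) :
    (parkingSum (1 + Polynomial.X : Polynomial ℚ) n).coeff r
      = ∑ p ∈ parkingFunctions n, ((parkingAreaNat p).choose r : ℚ) := by
  rw [parkingSum, Polynomial.finsetSum_coeff]
  exact Finset.sum_congr rfl fun p _ => Polynomial.coeff_one_add_X_pow ℚ _ _

theorem coeff_areaSeries (r n : ℕ) : coeff n (areaSeries r)
    = 1 / n.factorial * ∑ p ∈ parkingFunctions n, ((parkingAreaNat p).choose r : ℚ) :=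
  coeff_mk _ _

/-- Substitute `q = 1 + t`: the coefficient of `t ^ r` in `q ^ area` is `area.choose r`. Both sides
of the quadratic recursion are divisible by `t`; cancel it and compare coefficients. -/
theorem solvesAreaEquation_areaSeries (r : ℕ) : SolvesAreaEquation areaSeries r := by
  set S : ℕ → Polynomial ℚ := fun n =>
    Polynomial.C (1 / n.factorial : ℚ) * parkingSum (1 + Polynomial.X) n with hS
  -- This is `(q ^ (m + 1) - 1) / (q - 1)` as a polynomial in `q - 1`; its coefficients are the
  -- weights in `chooseMul`.
  set B : ℕ → Polynomial ℚ := fun m => Polynomial.divX ((1 + Polynomial.X) ^ (m + 1)) with hB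
  have hSc : ∀ n r, (S n).coeff r = PowerSeries.coeff n (areaSeries r) := fun n r => by
    rw [hS, coeff_areaSeries, Polynomial.coeff_C_mul, coeff_parkingSum]
  have hBc : ∀ m j, (B m).coeff j = ((m + 1).choose (j + 1) : ℚ) := fun m j => by
    rw [hB, Polynomial.coeff_divX, Polynomial.coeff_one_add_X_pow]
  have hBX : ∀ m, (1 + Polynomial.X : Polynomial ℚ) ^ (m + 1) - 1 = Polynomial.X * B m := by
    intro m
    have := Polynomial.X_mul_divX_add ((1 + Polynomial.X : Polynomial ℚ) ^ (m + 1))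
    rw [Polynomial.coeff_one_add_X_pow] at this
    rw [hB, ← this]
    simp
  have hq : (1 + Polynomial.X : Polynomial ℚ) ≠ 0 := by
    intro h
    simpa using congrArg (Polynomial.eval 0) h
  ext n
  have h1 := sub_one_mul_parkingSum_succ hq n
  have h2 : Polynomial.C (1 / n.factorial : ℚ) * parkingSum (1 + Polynomial.X) (n + 1)
      = ∑ p ∈ antidiagonal n, S p.1 * (B p.2 * S p.2) := by
    refine mul_left_cancel₀ Polynomial.X_ne_zero ?_
    rw [add_sub_cancel_left] at h1
    refine h1.trans ?_
    rw [Finset.mul_sum]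
    refine Finset.sum_congr rfl fun p _ => ?_
    rw [hBX]
    simp only [hS, Polynomial.algebraMap_eq]
    ring
  have h3 := congrArg (fun f => Polynomial.coeff f r) h2
  simp only [Polynomial.finsetSum_coeff, Polynomial.coeff_mul, hSc, hBc] at h3
  rw [← Polynomial.coeff_mul, Polynomial.coeff_C_mul, coeff_parkingSum] at h3
  rw [coeff_derivative, coeff_areaSeries, map_sum]
  simp only [coeff_mul, map_sum, coeff_chooseMul]
  rw [Finset.sum_comm, ← h3, Nat.factorial_succ]
  push_cast
  have : (n.factorial : ℚ) ≠ 0 := by positivity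
  field_simp

theorem parkingFunctions_zero : parkingFunctions 0 = {Fin.elim0} := by
  ext p
  rw [mem_parkingFunctions, Finset.mem_singleton]
  exact ⟨fun _ => Subsingleton.elim _ _, fun _ => ⟨fun i => i.elim0, fun i => i.elim0⟩⟩

theorem coeff_zero_areaSeries (r : ℕ) : coeff 0 (areaSeries r) = if r = 0 then 1 else 0 := by
  rw [coeff_areaSeries, parkingFunctions_zero, Finset.sum_singleton, parkingAreaNat]
  rcases r with _ | r <;> simp

end AreaSystem

/-! ### Calculus of the tree function -/

section WaitSeries

open PowerSeries

/-- `W` is the solution of `W' = W * (X * W)'` with constant coefficient `1`. Then `X * W` is the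
tree function. -/
structure IsWaitSeries (W : ℚ⟦X⟧) : Prop where
  constantCoeff_eq : constantCoeff W = 1
  derivative_eq : d⁄dX ℚ W = W * (W + X * d⁄dX ℚ W)

/-- The series `1 / (1 - X * W)`. -/
noncomputable def geomWait (W : ℚ⟦X⟧) : ℚ⟦X⟧ := (1 - X * W)⁻¹

theorem one_sub_mul_geomWait (W : ℚ⟦X⟧) : (1 - X * W) * geomWait W = 1 :=
  PowerSeries.mul_inv_cancel _ (by simp)

theorem constantCoeff_geomWait (W : ℚ⟦X⟧) : constantCoeff (geomWait W) = 1 := by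
  have := congrArg constantCoeff (one_sub_mul_geomWait W)
  simpa using this

theorem geomWait_ne_zero (W : ℚ⟦X⟧) : geomWait W ≠ 0 := fun h => by
  have := constantCoeff_geomWait W
  simp [h] at this

/-- The operator `p ↦ X * p + X * (1 + X) ^ 2 * p'`. -/
noncomputable def waitOp (p : Polynomial ℚ) : Polynomial ℚ :=
  .X * p + .X * (1 + .X) ^ 2 * Polynomial.derivative p

/-- The action of `chooseMul j` on polynomials in `geomWait W - 1`, relative to `W`. -/
noncomputable def chooseOp : ℕ → Polynomial ℚ → Polynomial ℚ
  | 0, p => p + waitOp p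
  | j + 1, p => .C (1 / (j + 2 : ℚ)) * (waitOp (chooseOp j p) - .C (j : ℚ) * chooseOp j p)

theorem cast_mul_coeff (f : ℚ⟦X⟧) (n : ℕ) :
    (n : ℚ) * coeff n f = coeff n (X * d⁄dX ℚ f) := by
  rcases n with _ | n
  · simp
  · rw [coeff_succ_X_mul, coeff_derivative]
    push_cast
    ring

theorem chooseMul_zero (f : ℚ⟦X⟧) : chooseMul 0 f = f + X * d⁄dX ℚ f := by
  ext n
  rw [coeff_chooseMul, map_add]
  rcases n with _ | n
  · simp
  · rw [coeff_succ_X_mul, coeff_derivative]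
    simp only [zero_add, Nat.choose_one_right]
    push_cast
    ring

theorem chooseMul_succ (j : ℕ) (f : ℚ⟦X⟧) : chooseMul (j + 1) f
    = C (1 / (j + 2 : ℚ)) * (X * d⁄dX ℚ (chooseMul j f) - C (j : ℚ) * chooseMul j f) := by
  ext n
  have h : ((n + 1).choose (j + 1 + 1) : ℚ) * (j + 2)
      = (n + 1).choose (j + 1) * (n - j) := by
    have h1 := congrArg (Nat.cast (R := ℚ)) (Nat.choose_succ_right_eq (n + 1) (j + 1))
    rcases le_or_gt j n with h2 | h2
    · rw [Nat.add_sub_add_right, Nat.cast_mul, Nat.cast_mul, Nat.cast_sub h2] at h1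
      push_cast at h1
      linarith
    · simp [Nat.choose_eq_zero_of_lt (show n + 1 < j + 1 + 1 by omega),
        Nat.choose_eq_zero_of_lt (show n + 1 < j + 1 by omega)]
  have h4 : (j + 2 : ℚ) ≠ 0 := by positivity
  rw [coeff_C_mul, map_sub, ← cast_mul_coeff, coeff_C_mul, coeff_chooseMul, coeff_chooseMul]
  field_simp
  linear_combination coeff n f * h

namespace IsWaitSeries

variable {W : ℚ⟦X⟧} (h : IsWaitSeries W)
include h

theorem X_mul_derivative : X * d⁄dX ℚ W = W * (geomWait W - 1) := by
  have h1 := one_sub_mul_geomWait W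
  have h2 := h.derivative_eq
  linear_combination (X * geomWait W) * h2 + (-X * d⁄dX ℚ W - W) * h1

theorem X_mul_derivative_X_mul : X * d⁄dX ℚ (X * W) = geomWait W - 1 := by
  have h1 := one_sub_mul_geomWait W
  rw [Derivation.leibniz, derivative_X, smul_eq_mul, smul_eq_mul]
  linear_combination X * h.X_mul_derivative - h1

theorem X_mul_derivative_geomWait :
    X * d⁄dX ℚ (geomWait W) = geomWait W ^ 2 * (geomWait W - 1) := by
  have h1 := one_sub_mul_geomWait W
  have h2 := congrArg (fun f => X * d⁄dX ℚ f) h1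
  have h3 := h.X_mul_derivative_X_mul
  simp only [Derivation.leibniz, smul_eq_mul, map_sub, Derivation.map_one_eq_zero] at h2 h3
  linear_combination geomWait W * h2 + geomWait W ^ 2 * h3 - X * d⁄dX ℚ (geomWait W) * h1

theorem X_mul_derivative_geomWait_pow (k : ℕ) :
    X * d⁄dX ℚ (geomWait W ^ (k + 1))
      = C (k + 1 : ℚ) * (geomWait W ^ (k + 3) - geomWait W ^ (k + 2)) := by
  rw [derivative_pow, Nat.add_sub_cancel]
  simp only [map_add, map_natCast, map_one]
  push_cast
  linear_combination ((k : ℚ⟦X⟧) + 1) * geomWait W ^ k * h.X_mul_derivative_geomWait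

theorem X_mul_derivative_aeval (p : Polynomial ℚ) :
    X * d⁄dX ℚ (Polynomial.aeval (geomWait W - 1) p)
      = Polynomial.aeval (geomWait W - 1) (.X * (1 + .X) ^ 2 * Polynomial.derivative p) := by
  have h1 := h.X_mul_derivative_geomWait
  rw [Derivation.map_aeval, smul_eq_mul, map_sub, Derivation.map_one_eq_zero, sub_zero]
  simp only [map_mul, map_add, map_pow, map_one, Polynomial.aeval_X]
  linear_combination Polynomial.aeval (geomWait W - 1) (Polynomial.derivative p) * h1

theorem X_mul_derivative_mul_aeval (p : Polynomial ℚ) :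
    X * d⁄dX ℚ (W * Polynomial.aeval (geomWait W - 1) p)
      = W * Polynomial.aeval (geomWait W - 1) (waitOp p) := by
  have h1 := h.X_mul_derivative
  have h2 := h.X_mul_derivative_aeval p
  rw [waitOp, map_add, ← h2, Derivation.leibniz, smul_eq_mul, smul_eq_mul, map_mul,
    Polynomial.aeval_X]
  linear_combination Polynomial.aeval (geomWait W - 1) p * h1

theorem chooseMul_mul_aeval (j : ℕ) (p : Polynomial ℚ) :
    chooseMul j (W * Polynomial.aeval (geomWait W - 1) p)
      = W * Polynomial.aeval (geomWait W - 1) (chooseOp j p) := by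
  have hC : ∀ c : ℚ, Polynomial.aeval (geomWait W - 1) (Polynomial.C c) = (C c : ℚ⟦X⟧) :=
    fun c => Polynomial.aeval_C _ c
  induction j with
  | zero => rw [chooseMul_zero, h.X_mul_derivative_mul_aeval, chooseOp, map_add, mul_add]
  | succ j ih =>
    rw [chooseMul_succ, ih, h.X_mul_derivative_mul_aeval, chooseOp, map_mul, map_sub, map_mul,
      hC, hC]
    ring

/-- Write `z = geomWait W - 1`. After multiplication by `X`, the left side is `W` times `waitOp (V
r)` at `z`, and the right side carries a factor `X * W = z / (1 + z)`. Cancelling `z` and clearing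
the denominator gives the hypothesis. -/
theorem solvesAreaEquation_mul_aeval {V : ℕ → Polynomial ℚ} {r : ℕ}
    (hV : (1 + .X) * (V r + (1 + .X) ^ 2 * Polynomial.derivative (V r))
      = ∑ x ∈ Finset.HasAntidiagonal.antidiagonal r,
        V x.1 * ∑ y ∈ Finset.HasAntidiagonal.antidiagonal x.2, chooseOp y.1 (V y.2)) :
    SolvesAreaEquation (fun r => W * Polynomial.aeval (geomWait W - 1) (V r)) r := by
  have h1 := one_sub_mul_geomWait W
  have h2 := congrArg (Polynomial.aeval (geomWait W - 1)) hV
  rw [SolvesAreaEquation]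
  refine mul_left_cancel₀ X_ne_zero ?_
  rw [h.X_mul_derivative_mul_aeval]
  simp only [h.chooseMul_mul_aeval, ← Finset.mul_sum, mul_assoc, ← map_sum]
  have h3 : ∀ x : ℕ × ℕ, Polynomial.aeval (geomWait W - 1) (V x.1) * (W *
      Polynomial.aeval (geomWait W - 1)
        (∑ y ∈ Finset.HasAntidiagonal.antidiagonal x.2, chooseOp y.1 (V y.2)))
      = W * Polynomial.aeval (geomWait W - 1)
        (V x.1 * ∑ y ∈ Finset.HasAntidiagonal.antidiagonal x.2, chooseOp y.1 (V y.2)) := by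
    intro x
    rw [map_mul]
    ring
  rw [Finset.sum_congr rfl fun x _ => h3 x, ← Finset.mul_sum, ← map_sum, ← h2, waitOp]
  simp only [map_mul, map_add, map_pow, map_one, Polynomial.aeval_X]
  linear_combination (W * (Polynomial.aeval (geomWait W - 1) (V r) + geomWait W ^ 2 *
    Polynomial.aeval (geomWait W - 1) (Polynomial.derivative (V r)))) * h1

theorem mul_coeff_geomWait_pow (m k : ℕ) :
    (k + 1 : ℚ) * (coeff m (geomWait W ^ (k + 3)) - coeff m (geomWait W ^ (k + 2)))
      = m * coeff m (geomWait W ^ (k + 1)) := by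
  rw [cast_mul_coeff, h.X_mul_derivative_geomWait_pow, coeff_C_mul, map_sub]

theorem mul_coeff_X_mul (m : ℕ) (hm : m ≠ 0) :
    (m : ℚ) * coeff m (X * W) = coeff m (geomWait W) := by
  rw [cast_mul_coeff, h.X_mul_derivative_X_mul, map_sub, coeff_one, if_neg hm, sub_zero]

/-- With `T = X * W` and `Y = geomWait W`, the difference of the two series is `T ^ k`, and `X * (T
^ k)' = k * T ^ k * Y`. Iterating this replaces Lagrange inversion. -/
theorem coeff_X_mul_pow_mul_geomWait_step (m k : ℕ) :
    (m : ℚ) * (coeff m ((X * W) ^ k * geomWait W) - coeff m ((X * W) ^ (k + 1) * geomWait W))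
      = k * coeff m ((X * W) ^ k * geomWait W) := by
  have h1 := one_sub_mul_geomWait W
  have h2 : (X * W) ^ k * geomWait W - (X * W) ^ (k + 1) * geomWait W = (X * W) ^ k := by
    linear_combination (X * W) ^ k * h1
  rw [← map_sub, h2, cast_mul_coeff, derivative_pow]
  rcases k with _ | k
  · simp
  · rw [← map_natCast C, mul_assoc, mul_left_comm, coeff_C_mul]
    congr 2
    rw [Nat.add_sub_cancel]
    linear_combination (X * W) ^ k * h.X_mul_derivative_X_mul + (X * W) ^ k * h1

theorem coeff_X_mul_pow_mul_geomWait (k d : ℕ) :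
    coeff (k + d) ((X * W) ^ k * geomWait W) = ((k + d : ℕ) : ℚ) ^ d / d.factorial := by
  induction d generalizing k with
  | zero =>
    rw [mul_pow, mul_assoc, add_comm, coeff_X_pow_mul, coeff_zero_eq_constantCoeff_apply, map_mul,
      map_pow, h.constantCoeff_eq, constantCoeff_geomWait]
    simp
  | succ d ih =>
    have h1 := h.coeff_X_mul_pow_mul_geomWait_step (k + (d + 1)) k
    have h2 := ih (k + 1)
    have h3 : k + 1 + d = k + (d + 1) := by ring
    rw [h3] at h2
    rw [h2] at h1
    have h4 : (d.factorial : ℚ) ≠ 0 := by positivity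
    have h5 : (d + 1 : ℚ) ≠ 0 := by positivity
    refine mul_left_cancel₀ h5 ?_
    rw [Nat.factorial_succ, pow_succ]
    push_cast at h1 ⊢
    field_simp at h1 ⊢
    linear_combination h1

theorem coeff_geomWait (m : ℕ) : coeff m (geomWait W) = (m : ℚ) ^ m / m.factorial := by
  have := h.coeff_X_mul_pow_mul_geomWait 0 m
  simpa using this

/-- Expand one factor of `Y ^ 2` as a geometric series in `T = X * W`; the remainder contains `T ^
(m + 1)` and does not reach order `m`. -/
theorem coeff_geomWait_sq (m : ℕ) :
    coeff m (geomWait W ^ 2) = ∑ d ∈ Finset.range (m + 1), (m : ℚ) ^ d / d.factorial := by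
  have h1 := one_sub_mul_geomWait W
  have h2 : ∀ n, geomWait W ^ 2 = ∑ k ∈ Finset.range n, (X * W) ^ k * geomWait W
      + (X * W) ^ n * geomWait W ^ 2 := by
    intro n
    induction n with
    | zero => simp
    | succ n ih =>
      rw [Finset.sum_range_succ]
      linear_combination ih + (X * W) ^ n * geomWait W * h1
  rw [h2 (m + 1), map_add, mul_pow X W, mul_assoc, coeff_X_pow_mul', if_neg (by omega), add_zero,
    map_sum, ← Finset.sum_range_reflect]
  refine Finset.sum_congr rfl fun d hd => ?_
  have hd : d ≤ m := Nat.lt_succ_iff.1 (Finset.mem_range.1 hd)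
  have h3 := h.coeff_X_mul_pow_mul_geomWait (m - d) d
  rw [Nat.sub_add_cancel hd] at h3
  exact h3

end IsWaitSeries

theorem isWaitSeries_areaSeries : IsWaitSeries (areaSeries 0) where
  constantCoeff_eq := by
    rw [← coeff_zero_eq_constantCoeff_apply, coeff_zero_areaSeries, if_pos rfl]
  derivative_eq := by
    have := solvesAreaEquation_areaSeries 0
    rw [SolvesAreaEquation] at this
    simpa [chooseMul_zero] using this

theorem areaSeries_eq_mul_aeval {V : ℕ → Polynomial ℚ} {R : ℕ}
    (h0 : ∀ r ≤ R, (V r).eval 0 = if r = 0 then 1 else 0)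
    (hV : ∀ r ≤ R, (1 + .X) * (V r + (1 + .X) ^ 2 * Polynomial.derivative (V r))
      = ∑ x ∈ Finset.HasAntidiagonal.antidiagonal r,
        V x.1 * ∑ y ∈ Finset.HasAntidiagonal.antidiagonal x.2, chooseOp y.1 (V y.2))
    {r : ℕ} (hr : r ≤ R) : areaSeries r
      = areaSeries 0 * Polynomial.aeval (geomWait (areaSeries 0) - 1) (V r) := by
  refine SolvesAreaEquation.unique (W := fun r => areaSeries 0 *
    Polynomial.aeval (geomWait (areaSeries 0) - 1) (V r))
    (fun r _ => solvesAreaEquation_areaSeries r)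
    (fun r hr => isWaitSeries_areaSeries.solvesAreaEquation_mul_aeval (hV r hr)) ?_ hr
  intro r hr
  have h1 : constantCoeff (Polynomial.aeval (geomWait (areaSeries 0) - 1) (V r))
      = (V r).eval 0 := by
    have h2 := Polynomial.hom_eval₂ (V r) (algebraMap ℚ ℚ⟦X⟧) (constantCoeff (R := ℚ))
      (geomWait (areaSeries 0) - 1)
    rw [map_sub, constantCoeff_geomWait, map_one, sub_self] at h2
    rw [Polynomial.aeval_def, h2, Subsingleton.elim (RingHom.comp _ _) (RingHom.id ℚ)]
    rfl
  rw [coeff_zero_areaSeries, coeff_zero_eq_constantCoeff_apply, map_mul,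
    isWaitSeries_areaSeries.constantCoeff_eq, one_mul, h1, h0 r hr]

end WaitSeries

/-! ### The explicit polynomials up to order five -/

/-- The polynomials that express the binomial moments of area up to order five. -/
noncomputable def areaPoly : ℕ → Polynomial ℚ
  | 0 => 1
  | 1 => .C (1 / 2) * .X ^ 2
  | 2 => .X ^ 3 + .C (37 / 24) * .X ^ 4 + .C (5 / 8) * .X ^ 5
  | 3 => .C (1 / 6) * .X ^ 3 + .C (23 / 6) * .X ^ 4 + .C (91 / 8) * .X ^ 5
      + .C (677 / 48) * .X ^ 6 + .C (395 / 48) * .X ^ 7 + .C (15 / 8) * .X ^ 8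
  | 4 => .C (15 / 8) * .X ^ 4 + .C (73 / 3) * .X ^ 5 + .C (23087 / 240) * .X ^ 6
      + .C (3055 / 16) * .X ^ 7 + .C (83777 / 384) * .X ^ 8 + .C (169117 / 1152) * .X ^ 9
      + .C (20905 / 384) * .X ^ 10 + .C (1105 / 128) * .X ^ 11
  | 5 => .C (5 / 12) * .X ^ 4 + .C (849 / 40) * .X ^ 5 + .C (4433 / 20) * .X ^ 6
      + .C (91123 / 90) * .X ^ 7 + .C (252785 / 96) * .X ^ 8 + .C (6251927 / 1440) * .X ^ 9
      + .C (10918351 / 2304) * .X ^ 10 + .C (2640575 / 768) * .X ^ 11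
      + .C (3693455 / 2304) * .X ^ 12 + .C (335275 / 768) * .X ^ 13
      + .C (1695 / 32) * .X ^ 14
  | _ => 0

theorem chooseOp_0_areaPoly_0 :
    chooseOp 0 (areaPoly 0) = 1 + .X := by
  rw [chooseOp, waitOp, areaPoly]
  refine Polynomial.funext fun x => ?_
  simp

theorem chooseOp_1_areaPoly_0 :
    chooseOp 1 (areaPoly 0) = .X + .C (3 / 2) * .X ^ 2 + .C (1 / 2) * .X ^ 3 := by
  rw [chooseOp, chooseOp_0_areaPoly_0, waitOp]
  refine Polynomial.funext fun x => ?_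
  simp
  ring

theorem chooseOp_2_areaPoly_0 :
    chooseOp 2 (areaPoly 0) = .C (3 / 2) * .X ^ 2 + .C (19 / 6) * .X ^ 3
      + .C (13 / 6) * .X ^ 4 + .C (1 / 2) * .X ^ 5 := by
  rw [chooseOp, chooseOp_1_areaPoly_0, waitOp]
  refine Polynomial.funext fun x => ?_
  simp
  ring

theorem chooseOp_3_areaPoly_0 :
    chooseOp 3 (areaPoly 0) = .C (8 / 3) * .X ^ 3 + .C (59 / 8) * .X ^ 4
      + .C (61 / 8) * .X ^ 5 + .C (85 / 24) * .X ^ 6 + .C (5 / 8) * .X ^ 7 := by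
  rw [chooseOp, chooseOp_2_areaPoly_0, waitOp]
  refine Polynomial.funext fun x => ?_
  simp
  ring

theorem chooseOp_4_areaPoly_0 :
    chooseOp 4 (areaPoly 0) = .C (125 / 24) * .X ^ 4 + .C (717 / 40) * .X ^ 5
      + .C (124 / 5) * .X ^ 6 + .C (52 / 3) * .X ^ 7 + .C (49 / 8) * .X ^ 8
      + .C (7 / 8) * .X ^ 9 := by
  rw [chooseOp, chooseOp_3_areaPoly_0, waitOp]
  refine Polynomial.funext fun x => ?_
  simp
  ring

theorem chooseOp_5_areaPoly_0 :
    chooseOp 5 (areaPoly 0) = .C (54 / 5) * .X ^ 5 + .C (32113 / 720) * .X ^ 6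
      + .C (6187 / 80) * .X ^ 7 + .C (4333 / 60) * .X ^ 8 + .C (1379 / 36) * .X ^ 9
      + .C (175 / 16) * .X ^ 10 + .C (21 / 16) * .X ^ 11 := by
  rw [chooseOp, chooseOp_4_areaPoly_0, waitOp]
  refine Polynomial.funext fun x => ?_
  simp
  ring

theorem chooseOp_0_areaPoly_1 :
    chooseOp 0 (areaPoly 1) = .C (3 / 2) * .X ^ 2 + .C (5 / 2) * .X ^ 3 + .X ^ 4 := by
  rw [chooseOp, waitOp, areaPoly]
  refine Polynomial.funext fun x => ?_
  simp
  ring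

theorem chooseOp_1_areaPoly_1 :
    chooseOp 1 (areaPoly 1) = .C (3 / 2) * .X ^ 2 + .C (15 / 2) * .X ^ 3
      + .C (49 / 4) * .X ^ 4 + .C (33 / 4) * .X ^ 5 + .C 2 * .X ^ 6 := by
  rw [chooseOp, chooseOp_0_areaPoly_1, waitOp]
  refine Polynomial.funext fun x => ?_
  simp
  ring

theorem chooseOp_2_areaPoly_1 :
    chooseOp 2 (areaPoly 1) = .C (1 / 2) * .X ^ 2 + .C (15 / 2) * .X ^ 3
      + .C (123 / 4) * .X ^ 4 + .C (221 / 4) * .X ^ 5 + .C (599 / 12) * .X ^ 6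
      + .C (269 / 12) * .X ^ 7 + .C 4 * .X ^ 8 := by
  rw [chooseOp, chooseOp_1_areaPoly_1, waitOp]
  refine Polynomial.funext fun x => ?_
  simp
  ring

theorem chooseOp_3_areaPoly_1 :
    chooseOp 3 (areaPoly 1) = .C (5 / 2) * .X ^ 3 + .C (115 / 4) * .X ^ 4
      + .C (465 / 4) * .X ^ 5 + .C (11165 / 48) * .X ^ 6 + .C (4149 / 16) * .X ^ 7
      + .C (2639 / 16) * .X ^ 8 + .C (2699 / 48) * .X ^ 9 + .C 8 * .X ^ 10 := by
  rw [chooseOp, chooseOp_2_areaPoly_1, waitOp]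
  refine Polynomial.funext fun x => ?_
  simp
  ring

theorem chooseOp_4_areaPoly_1 :
    chooseOp 4 (areaPoly 1) = .C (37 / 4) * .X ^ 4 + .C (399 / 4) * .X ^ 5
      + .C (6693 / 16) * .X ^ 6 + .C (222833 / 240) * .X ^ 7 + .C 1222 * .X ^ 8
      + .C (9913 / 10) * .X ^ 9 + .C (23461 / 48) * .X ^ 10 + .C (2157 / 16) * .X ^ 11
      + .C 16 * .X ^ 12 := by
  rw [chooseOp, chooseOp_3_areaPoly_1, waitOp]
  refine Polynomial.funext fun x => ?_
  simp
  ring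

theorem chooseOp_0_areaPoly_2 :
    chooseOp 0 (areaPoly 2) = .C 4 * .X ^ 3 + .C (353 / 24) * .X ^ 4 + .C (165 / 8) * .X ^ 5
      + .C (313 / 24) * .X ^ 6 + .C (25 / 8) * .X ^ 7 := by
  rw [chooseOp, waitOp, areaPoly]
  refine Polynomial.funext fun x => ?_
  simp
  ring

theorem chooseOp_1_areaPoly_2 :
    chooseOp 1 (areaPoly 2) = .C 6 * .X ^ 3 + .C (521 / 12) * .X ^ 4 + .C (495 / 4) * .X ^ 5
      + .C (8735 / 48) * .X ^ 6 + .C (7069 / 48) * .X ^ 7 + .C (1001 / 16) * .X ^ 8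
      + .C (175 / 16) * .X ^ 9 := by
  rw [chooseOp, chooseOp_0_areaPoly_2, waitOp]
  refine Polynomial.funext fun x => ?_
  simp
  ring

theorem chooseOp_2_areaPoly_2 :
    chooseOp 2 (areaPoly 2) = .C 4 * .X ^ 3 + .C (689 / 12) * .X ^ 4 + .C (1205 / 4) * .X ^ 5
      + .C (13039 / 16) * .X ^ 6 + .C (185669 / 144) * .X ^ 7 + .C (29911 / 24) * .X ^ 8
      + .C (52367 / 72) * .X ^ 9 + .C (11333 / 48) * .X ^ 10 + .C (525 / 16) * .X ^ 11 := by
  rw [chooseOp, chooseOp_1_areaPoly_2, waitOp]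
  refine Polynomial.funext fun x => ?_
  simp
  ring

theorem chooseOp_3_areaPoly_2 :
    chooseOp 3 (areaPoly 2) = .X ^ 3 + .C (857 / 24) * .X ^ 4 + .C (2865 / 8) * .X ^ 5
      + .C (40819 / 24) * .X ^ 6 + .C (333851 / 72) * .X ^ 7 + .C (1521979 / 192) * .X ^ 8
      + .C (1694581 / 192) * .X ^ 9 + .C (1848833 / 288) * .X ^ 10
      + .C (94395 / 32) * .X ^ 11 + .C (149555 / 192) * .X ^ 12 + .C (5775 / 64) * .X ^ 13 := by
  rw [chooseOp, chooseOp_2_areaPoly_2, waitOp]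
  refine Polynomial.funext fun x => ?_
  simp
  ring

theorem chooseOp_0_areaPoly_3 :
    chooseOp 0 (areaPoly 3) = .C (2 / 3) * .X ^ 3 + .C (61 / 3) * .X ^ 4
      + .C (413 / 4) * .X ^ 5 + .C (3827 / 16) * .X ^ 6 + .C (4897 / 16) * .X ^ 7
      + .C (3599 / 16) * .X ^ 8 + .C (4295 / 48) * .X ^ 9 + .C 15 * .X ^ 10 := by
  rw [chooseOp, waitOp, areaPoly]
  refine Polynomial.funext fun x => ?_
  simp
  ring

theorem chooseOp_1_areaPoly_3 :
    chooseOp 1 (areaPoly 3) = .X ^ 3 + .C 43 * .X ^ 4 + .C (2805 / 8) * .X ^ 5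
      + .C (63653 / 48) * .X ^ 6 + .C (46145 / 16) * .X ^ 7 + .C (125209 / 32) * .X ^ 8
      + .C (108347 / 32) * .X ^ 9 + .C (175181 / 96) * .X ^ 10 + .C (17925 / 32) * .X ^ 11
      + .C 75 * .X ^ 12 := by
  rw [chooseOp, chooseOp_0_areaPoly_3, waitOp]
  refine Polynomial.funext fun x => ?_
  simp
  ring

theorem chooseOp_2_areaPoly_3 :
    chooseOp 2 (areaPoly 3) = .C (2 / 3) * .X ^ 3 + .C (136 / 3) * .X ^ 4
      + .C (1195 / 2) * .X ^ 5 + .C (511651 / 144) * .X ^ 6 + .C (1742249 / 144) * .X ^ 7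
      + .C (838475 / 32) * .X ^ 8 + .C (3641359 / 96) * .X ^ 9 + .C (224113 / 6) * .X ^ 10
      + .C (74395 / 3) * .X ^ 11 + .C (3067835 / 288) * .X ^ 12 + .C (85725 / 32) * .X ^ 13
      + .C 300 * .X ^ 14 := by
  rw [chooseOp, chooseOp_1_areaPoly_3, waitOp]
  refine Polynomial.funext fun x => ?_
  simp
  ring

theorem chooseOp_0_areaPoly_4 :
    chooseOp 0 (areaPoly 4) = .C (75 / 8) * .X ^ 4 + .C (1303 / 8) * .X ^ 5
      + .C (75883 / 80) * .X ^ 6 + .C (231977 / 80) * .X ^ 7 + .C (3459047 / 640) * .X ^ 8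
      + .C (7503517 / 1152) * .X ^ 9 + .C (739217 / 144) * .X ^ 10
      + .C (41089 / 16) * .X ^ 11 + .C (285295 / 384) * .X ^ 12 + .C (12155 / 128) * .X ^ 13 := by
  rw [chooseOp, waitOp, areaPoly]
  refine Polynomial.funext fun x => ?_
  simp
  ring

theorem chooseOp_1_areaPoly_4 :
    chooseOp 1 (areaPoly 4) = .C (75 / 4) * .X ^ 4 + .C (3595 / 8) * .X ^ 5
      + .C (150407 / 40) * .X ^ 6 + .C (668867 / 40) * .X ^ 7 + .C (92425 / 2) * .X ^ 8
      + .C (3416003 / 40) * .X ^ 9 + .C (1257572299 / 11520) * .X ^ 10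
      + .C (74754199 / 768) * .X ^ 11 + .C (34362841 / 576) * .X ^ 12
      + .C (4613479 / 192) * .X ^ 13 + .C (1469365 / 256) * .X ^ 14
      + .C (158015 / 256) * .X ^ 15 := by
  rw [chooseOp, chooseOp_0_areaPoly_4, waitOp]
  refine Polynomial.funext fun x => ?_
  simp
  ring

theorem chooseOp_0_areaPoly_5 :
    chooseOp 0 (areaPoly 5) = .C (25 / 12) * .X ^ 4 + .C (1311 / 10) * .X ^ 5
      + .C (214403 / 120) * .X ^ 6 + .C (3991463 / 360) * .X ^ 7
      + .C (19303517 / 480) * .X ^ 8 + .C (45728407 / 480) * .X ^ 9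
      + .C (1793475809 / 11520) * .X ^ 10 + .C (690623033 / 3840) * .X ^ 11
      + .C (9427725 / 64) * .X ^ 12 + .C (48389225 / 576) * .X ^ 13
      + .C (24436445 / 768) * .X ^ 14 + .C (5538295 / 768) * .X ^ 15
      + .C (11865 / 16) * .X ^ 16 := by
  rw [chooseOp, waitOp, areaPoly]
  refine Polynomial.funext fun x => ?_
  simp
  ring

theorem X_mul_areaPoly_1 :
    .X * areaPoly 1 = (1 + .X) *
      (.C (3 / 2) + .C (-3 / 2) * (1 + .X) + .C (1 / 2) * (1 + .X) ^ 2)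
      + .C (-1 / 2) := by
  rw [areaPoly]
  refine Polynomial.funext fun x => ?_
  simp
  ring

/-- Division with remainder by `1 + X`, with the quotient expanded in powers of `1 + X` because `1 +
X` stands for `geomWait`. -/
theorem X_mul_areaPoly_5 :
    .X * areaPoly 5 = (1 + .X) *
      (.C (17 / 1920) + .C (19 / 1920) * (1 + .X) + .C (827 / 3840) * (1 + .X) ^ 2
      + .C (-3127 / 2304) * (1 + .X) ^ 3 + .C (15817 / 2304) * (1 + .X) ^ 4
      + .C (-333787 / 11520) * (1 + .X) ^ 5 + .C (598393 / 5760) * (1 + .X) ^ 6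
      + .C (-1789043 / 5760) * (1 + .X) ^ 7 + .C (54209 / 72) * (1 + .X) ^ 8
      + .C (-4060441 / 2880) * (1 + .X) ^ 9 + .C (4411441 / 2304) * (1 + .X) ^ 10
      + .C (-4091315 / 2304) * (1 + .X) ^ 11 + .C (2426105 / 2304) * (1 + .X) ^ 12
      + .C (-274925 / 768) * (1 + .X) ^ 13 + .C (1695 / 32) * (1 + .X) ^ 14)
      + .C (-3 / 160) := by
  rw [areaPoly]
  refine Polynomial.funext fun x => ?_
  simp
  ring

theorem eval_zero_areaPoly {r : ℕ} (hr : r ≤ 5) :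
    (areaPoly r).eval 0 = if r = 0 then 1 else 0 := by
  interval_cases r <;> simp [areaPoly]

-- Once the values of `chooseOp` are tabulated, each order is an identity between explicit
-- polynomials, checked pointwise by `ring`.
set_option linter.unusedSimpArgs false in
theorem areaPoly_equation {r : ℕ} (hr : r ≤ 5) :
    (1 + .X) * (areaPoly r + (1 + .X) ^ 2 * Polynomial.derivative (areaPoly r))
      = ∑ x ∈ Finset.HasAntidiagonal.antidiagonal r,
        areaPoly x.1 * ∑ y ∈ Finset.HasAntidiagonal.antidiagonal x.2,
          chooseOp y.1 (areaPoly y.2) := by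
  interval_cases r
  all_goals
    simp only [Finset.Nat.sum_antidiagonal_eq_sum_range_succ_mk, Finset.sum_range_succ,
      Finset.sum_range_zero, zero_add, Nat.reduceAdd, Nat.reduceSub, Nat.sub_zero, Nat.sub_self,
      chooseOp_0_areaPoly_0, chooseOp_1_areaPoly_0, chooseOp_2_areaPoly_0,
      chooseOp_3_areaPoly_0, chooseOp_4_areaPoly_0, chooseOp_5_areaPoly_0,
      chooseOp_0_areaPoly_1, chooseOp_1_areaPoly_1, chooseOp_2_areaPoly_1,
      chooseOp_3_areaPoly_1, chooseOp_4_areaPoly_1, chooseOp_0_areaPoly_2,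
      chooseOp_1_areaPoly_2, chooseOp_2_areaPoly_2, chooseOp_3_areaPoly_2,
      chooseOp_0_areaPoly_3, chooseOp_1_areaPoly_3, chooseOp_2_areaPoly_3,
      chooseOp_0_areaPoly_4, chooseOp_1_areaPoly_4, chooseOp_0_areaPoly_5]
    simp only [areaPoly]
    refine Polynomial.funext fun x => ?_
    simp
  all_goals ring

/-! ### Coefficient extraction and exact moments -/

section Moments

open PowerSeries

theorem areaSeries_eq_mul_aeval_areaPoly {r : ℕ} (hr : r ≤ 5) : areaSeries r
    = areaSeries 0 * Polynomial.aeval (geomWait (areaSeries 0) - 1) (areaPoly r) :=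
  areaSeries_eq_mul_aeval (fun _ => eval_zero_areaPoly) (fun _ => areaPoly_equation) hr

/-- With `T = X * areaSeries 0` and `Y = 1 / (1 - T)`, one has `T = (Y - 1) / Y`, so `hG` divided by
`1 + X = Y` gives the claim; the remainder `c / Y` is `c * (1 - T)`. -/
theorem X_mul_areaSeries {r : ℕ} (hr : r ≤ 5) {G : Polynomial ℚ} {c : ℚ}
    (hG : .X * areaPoly r = (1 + .X) * G + .C c) :
    X * areaSeries r = Polynomial.aeval (geomWait (areaSeries 0) - 1) G
      + C c * (1 - X * areaSeries 0) := by
  rw [areaSeries_eq_mul_aeval_areaPoly hr]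
  have h1 := one_sub_mul_geomWait (areaSeries 0)
  have h2 := congrArg (Polynomial.aeval (geomWait (areaSeries 0) - 1)) hG
  rw [map_add, map_mul, map_mul, map_add, map_one, Polynomial.aeval_X, Polynomial.aeval_C,
    algebraMap_eq] at h2
  refine mul_left_cancel₀ (geomWait_ne_zero (areaSeries 0)) ?_
  linear_combination h2 - (C c + Polynomial.aeval (geomWait (areaSeries 0) - 1) (areaPoly r)) * h1

theorem coeff_geomWait_add_three (m k : ℕ) :
    coeff m (geomWait (areaSeries 0) ^ (k + 3)) = coeff m (geomWait (areaSeries 0) ^ (k + 2))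
      + m / (k + 1) * coeff m (geomWait (areaSeries 0) ^ (k + 1)) := by
  have h := isWaitSeries_areaSeries.mul_coeff_geomWait_pow m k
  have hk : (k + 1 : ℚ) ≠ 0 := by positivity
  field_simp
  linear_combination h

theorem coeff_areaSeries_zero (n : ℕ) : (n + 1 : ℚ) * coeff n (areaSeries 0)
    = coeff (n + 1) (geomWait (areaSeries 0)) := by
  rw [← isWaitSeries_areaSeries.mul_coeff_X_mul (n + 1) n.succ_ne_zero, coeff_succ_X_mul]
  push_cast
  ring

theorem coeff_areaSeries_one (n : ℕ) : 2 * coeff n (areaSeries 1)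
    = coeff (n + 1) (geomWait (areaSeries 0) ^ 2) - 3 * coeff (n + 1) (geomWait (areaSeries 0))
      + coeff n (areaSeries 0) := by
  have h := congrArg (coeff (n + 1)) (X_mul_areaSeries (by norm_num) X_mul_areaPoly_1)
  simp only [map_add, map_mul, map_pow, map_one, Polynomial.aeval_X, Polynomial.aeval_C,
    algebraMap_eq, add_sub_cancel, coeff_succ_X_mul, coeff_C_mul, map_sub, coeff_one, coeff_C,
    Nat.succ_ne_zero, if_false] at h
  linear_combination 2 * h

/-- The three-term recurrence lowers the powers of `geomWait` from 14 down to 2 and 1, which are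
traded for `areaSeries 1` and `areaSeries 0`. The factor `120 = 5!` turns binomial into factorial
moments. -/
theorem coeff_areaSeries_five (n : ℕ) : 120 * coeff n (areaSeries 5)
    = (-(105845 / 110592) * (n : ℚ) ^ 7 - 2170159 / 290304 * (n : ℚ) ^ 6
        - 99955651 / 3870720 * (n : ℚ) ^ 5 - 30773609 / 725760 * (n : ℚ) ^ 4
        - 94846903 / 11612160 * (n : ℚ) ^ 3 + 24676991 / 483840 * (n : ℚ) ^ 2
        + 392763901 / 11612160 * (n : ℚ)) * coeff n (areaSeries 0)
      + (565 / 2048 * (n : ℚ) ^ 6 + 1005 / 128 * (n : ℚ) ^ 5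
        + 9832585 / 165888 * (n : ℚ) ^ 4 + 1111349 / 5184 * (n : ℚ) ^ 3
        + 826358527 / 1935360 * (n : ℚ) ^ 2 + 159943787 / 362880 * (n : ℚ)
        + 1024580441 / 5806080) * coeff n (areaSeries 1) := by
  have h := congrArg (coeff (n + 1)) (X_mul_areaSeries (by norm_num) X_mul_areaPoly_5)
  simp only [map_add, map_mul, map_pow, map_one, Polynomial.aeval_X, Polynomial.aeval_C,
    algebraMap_eq, add_sub_cancel, coeff_succ_X_mul, coeff_C_mul, map_sub, coeff_one, coeff_C,
    Nat.succ_ne_zero, if_false] at h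
  have h0 := coeff_areaSeries_zero n
  have h1 := coeff_areaSeries_one n
  have hc : ∀ k : ℕ, coeff (n + 1) (geomWait (areaSeries 0) ^ (k + 3))
      = coeff (n + 1) (geomWait (areaSeries 0) ^ (k + 2))
        + ((n : ℚ) + 1) / ((k : ℚ) + 1) * coeff (n + 1) (geomWait (areaSeries 0) ^ (k + 1)) := by
    intro k
    rw [coeff_geomWait_add_three]
    push_cast
    rfl
  have h2 : coeff (n + 1) (geomWait (areaSeries 0) ^ 2) = 2 * coeff n (areaSeries 1)
      + (3 * n + 2) * coeff n (areaSeries 0) := by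
    linear_combination -h1 - 3 * h0
  have c3 := hc 0
  have c4 := hc 1
  have c5 := hc 2
  have c6 := hc 3
  have c7 := hc 4
  have c8 := hc 5
  have c9 := hc 6
  have c10 := hc 7
  have c11 := hc 8
  have c12 := hc 9
  have c13 := hc 10
  have c14 := hc 11
  simp only [Nat.reduceAdd, zero_add, pow_one, Nat.cast_zero, Nat.cast_one, Nat.cast_ofNat]
    at c3 c4 c5 c6 c7 c8 c9 c10 c11 c12 c13 c14
  rw [c14, c13, c12, c11, c10, c9, c8, c7, c6, c5, c4, c3, h2, ← h0] at h
  linear_combination 120 * h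

/-- The exponential series of `n + 1` has two equal largest terms, those of index `n` and `n + 1`;
they are split off here. -/
theorem coeff_geomWait_sq_eq_sum (n : ℕ) :
    coeff (n + 1) (geomWait (areaSeries 0) ^ 2)
      = ∑ k ∈ Finset.range n, ((n : ℚ) + 1) ^ k / k.factorial
        + 2 * coeff (n + 1) (geomWait (areaSeries 0)) := by
  rw [isWaitSeries_areaSeries.coeff_geomWait_sq, isWaitSeries_areaSeries.coeff_geomWait,
    Finset.sum_range_succ, Finset.sum_range_succ, Nat.factorial_succ]
  have : (n.factorial : ℚ) ≠ 0 := by positivity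
  push_cast
  field_simp
  ring

theorem coeff_areaSeries_zero_pos (n : ℕ) : 0 < coeff n (areaSeries 0) := by
  have h := coeff_areaSeries_zero n
  rw [isWaitSeries_areaSeries.coeff_geomWait] at h
  have h1 : (0 : ℚ) < ((n + 1 : ℕ) : ℚ) ^ (n + 1) / (n + 1).factorial := by positivity
  rw [← h] at h1
  exact pos_of_mul_pos_right h1 (by positivity)

theorem sum_choose_parkingArea (r n : ℕ) :
    ∑ p ∈ parkingFunctions n, ((parkingAreaNat p).choose r : ℝ)
      = n.factorial * (coeff n (areaSeries r) : ℚ) := by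
  have : (n.factorial : ℝ) ≠ 0 := by positivity
  rw [coeff_areaSeries]
  push_cast
  field_simp

theorem parkingExpectation_choose (r n : ℕ) :
    (∑ p ∈ parkingFunctions n, ((parkingAreaNat p).choose r : ℝ)) / (parkingFunctions n).card
      = ((coeff n (areaSeries r) / coeff n (areaSeries 0) : ℚ) : ℝ) := by
  have h1 : ((parkingFunctions n).card : ℝ)
      = ∑ p ∈ parkingFunctions n, ((parkingAreaNat p).choose 0 : ℝ) := by simp
  have : (n.factorial : ℝ) ≠ 0 := by positivity
  rw [h1, sum_choose_parkingArea, sum_choose_parkingArea, mul_div_mul_left _ _ this]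
  push_cast
  rfl

theorem areaFactorialMoment_eq (r n : ℕ) : areaFactorialMoment r n
    = r.factorial * ((coeff n (areaSeries r) / coeff n (areaSeries 0) : ℚ) : ℝ) := by
  rw [← parkingExpectation_choose, areaFactorialMoment, parkingExpectation, ← mul_div_assoc,
    Finset.mul_sum]
  congr 1
  refine Finset.sum_congr rfl fun p hp => ?_
  rw [← (mem_parkingFunctions.1 hp).cast_parkingAreaNat, ← Nat.cast_mul,
    ← Nat.descFactorial_eq_factorial_mul_choose]
  induction r with
  | zero => simp
  | succ r ih =>
    rw [Finset.prod_range_succ, ih, Nat.descFactorial_succ, mul_comm, Nat.cast_mul]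
    rcases le_or_gt r (parkingAreaNat p) with h | h
    · rw [Nat.cast_sub h]
    -- If the area is below `r`, the falling factorial already vanishes, so the sign of the new
    -- factor is irrelevant.
    · simp [Nat.descFactorial_of_lt h]

theorem areaExpectation_eq (n : ℕ) : areaExpectation n
    = ((coeff n (areaSeries 1) / coeff n (areaSeries 0) : ℚ) : ℝ) := by
  have := areaFactorialMoment_eq 1 n
  simpa [areaFactorialMoment, areaExpectation] using this

theorem areaExpectation_eq_sum (n : ℕ) : areaExpectation n =
    -(n : ℝ) / 2 + 1 / 2 * (((n + 1).factorial : ℝ) / ((n : ℝ) + 1) ^ n) *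
      ∑ k ∈ Finset.range n, ((n : ℝ) + 1) ^ k / (k.factorial : ℝ) := by
  have h : coeff n (areaSeries 1) / coeff n (areaSeries 0)
      = -(n : ℚ) / 2 + 1 / 2 * (((n + 1).factorial : ℚ) / ((n : ℚ) + 1) ^ n) *
      ∑ k ∈ Finset.range n, ((n : ℚ) + 1) ^ k / (k.factorial : ℚ) := by
    have h0 := coeff_areaSeries_zero n
    have h1 := coeff_areaSeries_one n
    have h2 := coeff_geomWait_sq_eq_sum n
    have h3 := isWaitSeries_areaSeries.coeff_geomWait (n + 1)
    have h4 := coeff_areaSeries_zero_pos n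
    have h5 : ((n + 1).factorial : ℚ) ≠ 0 := by positivity
    have h6 : (n + 1 : ℚ) ≠ 0 := by positivity
    have h7 : ((n + 1).factorial : ℚ) / ((n : ℚ) + 1) ^ n * coeff n (areaSeries 0) = 1 := by
      rw [h3] at h0
      push_cast at h0
      field_simp at h0 ⊢
      rw [pow_succ] at h0
      exact mul_right_cancel₀ h6 (by linear_combination h0)
    rw [div_eq_iff h4.ne']
    linear_combination (1 / 2) * h1 + (1 / 2) * h2 + (1 / 2) * h0
      - (1 / 2) * (∑ k ∈ Finset.range n, ((n : ℚ) + 1) ^ k / (k.factorial : ℚ)) * h7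
  rw [areaExpectation_eq, h]
  push_cast
  rfl

theorem areaFactorialMoment_five (n : ℕ) : areaFactorialMoment 5 n =
      -(105845 / 110592) * (n : ℝ) ^ 7 - 2170159 / 290304 * (n : ℝ) ^ 6
        - 99955651 / 3870720 * (n : ℝ) ^ 5 - 30773609 / 725760 * (n : ℝ) ^ 4
        - 94846903 / 11612160 * (n : ℝ) ^ 3 + 24676991 / 483840 * (n : ℝ) ^ 2
        + 392763901 / 11612160 * (n : ℝ)
      + (565 / 2048 * (n : ℝ) ^ 6 + 1005 / 128 * (n : ℝ) ^ 5
        + 9832585 / 165888 * (n : ℝ) ^ 4 + 1111349 / 5184 * (n : ℝ) ^ 3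
        + 826358527 / 1935360 * (n : ℝ) ^ 2 + 159943787 / 362880 * (n : ℝ)
        + 1024580441 / 5806080) * areaExpectation n := by
  have h := congrArg (Rat.cast (K := ℝ)) (coeff_areaSeries_five n)
  have h4 : ((coeff n (areaSeries 0) : ℚ) : ℝ) ≠ 0 :=
    Rat.cast_ne_zero.2 (coeff_areaSeries_zero_pos n).ne'
  rw [areaExpectation_eq, areaFactorialMoment_eq]
  have h5 : ((Nat.factorial 5 : ℕ) : ℝ) = 120 := by norm_num [Nat.factorial]
  push_cast at h ⊢
  rw [h5, ← mul_div_assoc, h, add_div, mul_div_cancel_right₀ _ h4, mul_div_assoc]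

end Moments

/-! ### Ramanujan's function and Stirling's formula -/

section RamanujanQ

open Filter Topology

/-- The terms `N ^ k / k!` of the exponential series of `N`, divided by the one for `k = N`. -/
noncomputable def expTerm (N k : ℕ) : ℝ := N.factorial / (N : ℝ) ^ N * ((N : ℝ) ^ k / k.factorial)

theorem expTerm_nonneg (N k : ℕ) : 0 ≤ expTerm N k := by unfold expTerm; positivity

theorem expTerm_self {N : ℕ} (hN : 0 < N) : expTerm N N = 1 := by
  have : (N.factorial : ℝ) ≠ 0 := by positivity
  unfold expTerm
  field_simp

theorem expTerm_succ (N k : ℕ) : (k + 1 : ℝ) * expTerm N (k + 1) = N * expTerm N k := by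
  have : (k.factorial : ℝ) ≠ 0 := by positivity
  unfold expTerm
  rw [Nat.factorial_succ]
  push_cast
  field_simp
  ring

/-- The ratio of the two mirrored terms is the product of `1 - i ^ 2 / N ^ 2` over `1 ≤ i ≤ j`,
which lies between `1 - j ^ 3 / N ^ 2` and `1`. -/
theorem expTerm_add_le {N : ℕ} (hN : 0 < N) {j : ℕ} (hj : j < N) :
    expTerm N (N - 1 - j) ≤ expTerm N (N + j) ∧
      expTerm N (N + j) * (1 - (j : ℝ) ^ 3 / (N : ℝ) ^ 2) ≤ expTerm N (N - 1 - j) := by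
  have hN' : (0 : ℝ) < N := by exact_mod_cast hN
  induction j with
  | zero =>
    have h := expTerm_succ N (N - 1)
    rw [Nat.sub_add_cancel hN, Nat.cast_sub hN, expTerm_self hN] at h
    have h1 : expTerm N (N - 1) = 1 := by
      refine mul_left_cancel₀ hN'.ne' ?_
      rw [← h]; push_cast; ring
    simp [h1, expTerm_self hN]
  | succ j ih =>
    obtain ⟨h1, h2⟩ := ih (by omega)
    have h3 := expTerm_succ N (N - 1 - (j + 1))
    have h4 := expTerm_succ N (N + j)
    rw [show N - 1 - (j + 1) + 1 = N - 1 - j by omega] at h3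
    have h5 : ((N - 1 - (j + 1) : ℕ) : ℝ) + 1 = N - (j + 1) := by
      rw [Nat.sub_sub, Nat.cast_sub (by omega)]; push_cast; ring
    rw [h5] at h3
    push_cast at h4
    rw [add_assoc N j 1] at h4
    set a := expTerm N (N - 1 - (j + 1))
    set b := expTerm N (N - 1 - j)
    set c := expTerm N (N + j)
    set d := expTerm N (N + (j + 1))
    have hd : 0 ≤ d := expTerm_nonneg _ _
    obtain ⟨x, hx⟩ : ∃ x : ℝ, x = (j + 1) / N := ⟨_, rfl⟩
    have hjN : (j + 1 : ℝ) = x * N := by rw [hx]; field_simp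
    have hx0 : 0 ≤ x := by rw [hx]; positivity
    have hx1 : x ≤ 1 := by
      rw [hx, div_le_one hN']
      exact_mod_cast hj.le
    have ha : a = (1 - x) * b := by
      refine mul_left_cancel₀ hN'.ne' ?_
      rw [hjN] at h3
      linear_combination -h3
    have hc : c = (1 + x) * d := by
      refine mul_left_cancel₀ hN'.ne' ?_
      rw [add_assoc, hjN] at h4
      linear_combination -h4
    have hx2 : 0 ≤ 1 - x := by linarith
    have h6 := mul_le_mul_of_nonneg_left h1 hx2
    have h7 := mul_le_mul_of_nonneg_left h2 hx2
    rw [← ha] at h6 h7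
    rw [hc] at h6 h7
    have hs : (0 : ℝ) ≤ (j : ℝ) ^ 3 / (N : ℝ) ^ 2 := by positivity
    have hcube : (j : ℝ) ^ 3 / (N : ℝ) ^ 2 + x ^ 2 ≤ ((j + 1 : ℕ) : ℝ) ^ 3 / (N : ℝ) ^ 2 := by
      rw [hx, div_pow, ← add_div]
      gcongr
      push_cast
      have : (0 : ℝ) ≤ j := by positivity
      nlinarith
    refine ⟨by nlinarith [mul_nonneg hd (sq_nonneg x)], le_trans ?_ h7⟩
    have h8 : 1 - ((j + 1 : ℕ) : ℝ) ^ 3 / (N : ℝ) ^ 2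
        ≤ (1 - x ^ 2) * (1 - (j : ℝ) ^ 3 / (N : ℝ) ^ 2) := by
      nlinarith [mul_nonneg hs (sq_nonneg x)]
    calc _ ≤ d * ((1 - x ^ 2) * (1 - (j : ℝ) ^ 3 / (N : ℝ) ^ 2)) :=
          mul_le_mul_of_nonneg_left h8 hd
      _ = _ := by ring

theorem sum_cube_mul_expTerm_le {N : ℕ} (hN : 0 < N) (J : ℕ) :
    ∑ j ∈ Finset.range J, expTerm N (N + j) * ((j : ℝ) ^ 3 / (N : ℝ) ^ 2) ≤ 5 := by
  have hN' : (1 : ℝ) ≤ N := by exact_mod_cast hN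
  -- The added potential equals `5` at `J = 0`, and each step lowers it by at least the new summand,
  -- so the total never exceeds `5`.
  suffices H : ∑ j ∈ Finset.range J, expTerm N (N + j) * ((j : ℝ) ^ 3 / (N : ℝ) ^ 2)
      + (2 * ((J : ℝ) * (J - 1)) / N + 5) * (expTerm N (N + J) * ((N + J) / N)) ≤ 5 by
    refine le_trans (le_add_of_nonneg_right ?_) H
    refine mul_nonneg ?_ (mul_nonneg (expTerm_nonneg _ _) (by positivity))
    rcases Nat.eq_zero_or_pos J with rfl | hJ
    · simp
    · have : (1 : ℝ) ≤ J := by exact_mod_cast hJ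
      have : (0 : ℝ) ≤ (J : ℝ) - 1 := by linarith
      positivity
  induction J with
  | zero =>
    have : (N : ℝ) ≠ 0 := by positivity
    simp [expTerm_self hN, this]
  | succ J ih =>
    refine le_trans ?_ ih
    rw [Finset.sum_range_succ, add_assoc]
    gcongr _ + ?_
    have h1 := expTerm_succ N (N + J)
    rw [add_assoc N J 1] at h1
    have h2 : expTerm N (N + (J + 1)) * ((N + (J + 1 : ℕ)) / N) = expTerm N (N + J) := by
      field_simp
      push_cast at h1 ⊢
      linear_combination h1
    rw [h2]
    have h3 : (J : ℝ) ^ 3 / (N : ℝ) ^ 2 + (2 * (((J + 1 : ℕ) : ℝ) * ((J + 1 : ℕ) - 1)) / N + 5)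
        ≤ (2 * ((J : ℝ) * (J - 1)) / N + 5) * ((N + J) / N) := by
      have h4 : (2 * ((J : ℝ) * (J - 1)) / N + 5) * ((N + J) / N)
          - ((J : ℝ) ^ 3 / (N : ℝ) ^ 2 + (2 * (((J + 1 : ℕ) : ℝ) * ((J + 1 : ℕ) - 1)) / N + 5))
          = J * (((J : ℝ) - 1) ^ 2 + (N - 1)) / (N : ℝ) ^ 2 := by
        push_cast
        field_simp
        ring
      have h5 : (0 : ℝ) ≤ J * (((J : ℝ) - 1) ^ 2 + (N - 1)) / (N : ℝ) ^ 2 := by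
        have : (0 : ℝ) ≤ (N : ℝ) - 1 := by linarith
        positivity
      linarith
    have h6 := mul_le_mul_of_nonneg_left h3 (expTerm_nonneg N (N + J))
    linarith

theorem hasSum_expTerm (N : ℕ) :
    HasSum (expTerm N) (N.factorial / (N : ℝ) ^ N * Real.exp N) := by
  have h := NormedSpace.expSeries_div_hasSum_exp (N : ℝ)
  rw [← Real.exp_eq_exp_ℝ] at h
  exact h.mul_left _

/-- Ramanujan's function `Q`. -/
noncomputable def ramanujanQ (N : ℕ) : ℝ := ∑ k ∈ Finset.range N, expTerm N k

/-- The whole exponential series is `Q` plus its tail from `N` on. The tail dominates `Q` term by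
term after reflection, and exceeds it by at most the sum of the cubic errors. -/
theorem ramanujanQ_bounds {N : ℕ} (hN : 0 < N) :
    2 * ramanujanQ N ≤ N.factorial / (N : ℝ) ^ N * Real.exp N ∧
      N.factorial / (N : ℝ) ^ N * Real.exp N ≤ 2 * ramanujanQ N + 5 := by
  have hlim := (tendsto_add_atTop_iff_nat N).2 (hasSum_expTerm N).tendsto_sum_nat
  have hsplit : ∀ J, ∑ k ∈ Finset.range (J + N), expTerm N k
      = ramanujanQ N + ∑ j ∈ Finset.range J, expTerm N (N + j) := fun J => by
    rw [add_comm J N, Finset.sum_range_add, ramanujanQ]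
  have hQ : ramanujanQ N = ∑ j ∈ Finset.range N, expTerm N (N - 1 - j) :=
    (Finset.sum_range_reflect _ _).symm
  have hmono : ∀ J ≥ N, ∑ j ∈ Finset.range N, expTerm N (N + j)
      ≤ ∑ j ∈ Finset.range J, expTerm N (N + j) := fun J hJ =>
    Finset.sum_le_sum_of_subset_of_nonneg (Finset.range_subset_range.2 hJ)
      fun j _ _ => expTerm_nonneg _ _
  constructor
  · refine ge_of_tendsto hlim ?_
    filter_upwards [eventually_ge_atTop N] with J hJ
    have : ramanujanQ N ≤ ∑ j ∈ Finset.range N, expTerm N (N + j) := by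
      rw [hQ]
      exact Finset.sum_le_sum fun j hj => (expTerm_add_le hN (Finset.mem_range.1 hj)).1
    rw [hsplit]
    linarith [hmono J hJ]
  · refine le_of_tendsto hlim ?_
    filter_upwards [eventually_ge_atTop N] with J hJ
    obtain ⟨d, rfl⟩ := Nat.exists_eq_add_of_le hJ
    have h1 : ∑ j ∈ Finset.range N, expTerm N (N + j) ≤ ramanujanQ N
        + ∑ j ∈ Finset.range N, expTerm N (N + j) * ((j : ℝ) ^ 3 / (N : ℝ) ^ 2) := by
      rw [hQ, ← Finset.sum_add_distrib]
      refine Finset.sum_le_sum fun j hj => ?_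
      linarith [(expTerm_add_le hN (Finset.mem_range.1 hj)).2]
    -- Terms at distance at least `N` from the peak have no mirror image; there the cubic weight is
    -- at least one, so the same error sum absorbs them.
    have h2 : ∑ j ∈ Finset.range d, expTerm N (N + (N + j))
        ≤ ∑ j ∈ Finset.range d,
          expTerm N (N + (N + j)) * (((N + j : ℕ) : ℝ) ^ 3 / (N : ℝ) ^ 2) := by
      refine Finset.sum_le_sum fun j _ => le_mul_of_one_le_right (expTerm_nonneg _ _) ?_
      rw [one_le_div (by positivity)]
      calc (N : ℝ) ^ 2 ≤ ((N + j : ℕ) : ℝ) ^ 2 := by gcongr; omega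
        _ ≤ _ := pow_le_pow_right₀ (by exact_mod_cast (by omega : 1 ≤ N + j)) (by norm_num)
    have h3 := sum_cube_mul_expTerm_le hN (N + d)
    rw [Finset.sum_range_add] at h3
    rw [hsplit, Finset.sum_range_add]
    linarith

/-- The bound on the decrements of `log stirlingSeq` telescopes. The constant is not sharp: `1 / 2`
in place of `1 / 12` suffices. -/
theorem stirlingSeq_le (n : ℕ) :
    Stirling.stirlingSeq (n + 1) ≤ √Real.pi * Real.exp (1 / (2 * (n + 1))) := by
  have hmono : Monotone fun n : ℕ =>
      Real.log (Stirling.stirlingSeq (n + 1)) - 1 / (2 * ((n : ℝ) + 1)) := by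
    refine monotone_nat_of_le_succ fun n => ?_
    have h1 := Stirling.log_stirlingSeq_sdiff_le (n + 1)
    have h2 : 1 / (12 * ((n + 1 : ℕ) : ℝ) * ((n + 1 : ℕ) + 1))
        ≤ 1 / (2 * ((n : ℝ) + 1)) - 1 / (2 * (((n + 1 : ℕ) : ℝ) + 1)) := by
      push_cast
      rw [div_sub_div _ _ (by positivity) (by positivity), div_le_div_iff₀ (by positivity)
        (by positivity)]
      have : (0 : ℝ) ≤ n := by positivity
      nlinarith [pow_nonneg this 3]
    linarith
  have hlim : Tendsto (fun n : ℕ =>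
      Real.log (Stirling.stirlingSeq (n + 1)) - 1 / (2 * ((n : ℝ) + 1))) atTop
      (𝓝 (Real.log √Real.pi - 1 / 2 * 0)) := by
    refine Tendsto.sub ?_ ?_
    · exact ((tendsto_add_atTop_iff_nat 1).2 Stirling.tendsto_stirlingSeq_sqrt_pi).log
        (by positivity)
    · refine (tendsto_one_div_add_atTop_nhds_zero_nat.const_mul (1 / 2)).congr fun n => ?_
      field_simp
  have h := hmono.ge_of_tendsto hlim n
  rw [mul_zero, sub_zero, sub_le_iff_le_add] at h
  have hpos := Stirling.stirlingSeq'_pos n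
  rw [← Real.exp_log hpos, ← Real.exp_log (show 0 < √Real.pi by positivity), ← Real.exp_add]
  exact Real.exp_le_exp.2 h

theorem abs_ramanujanQ_sub_le {N : ℕ} (hN : 0 < N) :
    |ramanujanQ N - √(2 * Real.pi) / 2 * √N| ≤ 5 := by
  obtain ⟨n, rfl⟩ := Nat.exists_eq_succ_of_ne_zero hN.ne'
  rw [Nat.succ_eq_add_one] at hN ⊢
  set N := n + 1 with hNdef
  have hN1 : (1 : ℝ) ≤ N := by exact_mod_cast hN
  obtain ⟨h1, h2⟩ := ramanujanQ_bounds hN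
  have hM : N.factorial / (N : ℝ) ^ N * Real.exp N = √2 * √N * Stirling.stirlingSeq N := by
    rw [Stirling.stirlingSeq, div_pow, ← Real.exp_nat_mul, mul_one, Real.sqrt_mul (by norm_num)]
    have := Real.exp_pos N
    field_simp
  have hlow := Stirling.sqrt_pi_le_stirlingSeq (n := N) (by omega)
  have hup : Stirling.stirlingSeq N ≤ √Real.pi * (1 + 1 / N) := by
    refine (stirlingSeq_le n).trans ?_
    gcongr
    have hx : |1 / (2 * ((n : ℝ) + 1))| = 1 / (2 * ((n : ℝ) + 1)) := abs_of_nonneg (by positivity)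
    have h3 := Real.abs_exp_sub_one_le (x := 1 / (2 * ((n : ℝ) + 1))) (by
      rw [hx, div_le_one (by positivity)]
      have : (0 : ℝ) ≤ n := by positivity
      linarith)
    have h4 := (le_abs_self _).trans h3
    rw [hx] at h4
    have h5 : 2 * (1 / (2 * ((n : ℝ) + 1))) = 1 / N := by
      rw [hNdef]; push_cast; field_simp
    linarith
  have hs : √(2 * Real.pi) = √2 * √Real.pi := Real.sqrt_mul (by norm_num) _
  have hs2 : √2 * √Real.pi ≤ 3 := by
    rw [← hs, Real.sqrt_le_left (by norm_num)]
    linarith [Real.pi_lt_d2]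
  have hsN : √(N : ℝ) * (1 / N) ≤ 1 := by
    rw [mul_one_div, div_le_one (by linarith), Real.sqrt_le_left (by linarith)]
    nlinarith
  have hb1 : √2 * √N * √Real.pi ≤ √2 * √N * Stirling.stirlingSeq N := by gcongr
  have hb2 : √2 * √N * Stirling.stirlingSeq N ≤ √2 * √N * (√Real.pi * (1 + 1 / N)) := by gcongr
  have hb3 : √2 * √Real.pi * (√(N : ℝ) * (1 / N)) ≤ 3 * 1 := by gcongr
  rw [hM] at h1 h2
  rw [hs, abs_le]
  constructor <;> linarith

theorem areaExpectation_eq_ramanujanQ (n : ℕ) :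
    areaExpectation n = -(n : ℝ) / 2 + ((n : ℝ) + 1) / 2 * (ramanujanQ (n + 1) - 1) := by
  have h1 : (n.factorial : ℝ) ≠ 0 := by positivity
  have h2 : ramanujanQ (n + 1) - 1 = (n + 1).factorial / ((n : ℝ) + 1) ^ (n + 1)
      * ∑ k ∈ Finset.range n, ((n : ℝ) + 1) ^ k / (k.factorial : ℝ) := by
    rw [ramanujanQ, Finset.sum_range_succ, Finset.mul_sum]
    -- `Q (n + 1)` has one term more than the sum in the formula for `E₁`; this accounts for the `-
    -- 1`.
    have h3 : expTerm (n + 1) n = 1 := by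
      unfold expTerm
      rw [Nat.factorial_succ]
      push_cast
      field_simp
      ring
    rw [h3, add_sub_cancel_right]
    refine Finset.sum_congr rfl fun k _ => ?_
    unfold expTerm
    push_cast
    rfl
  rw [areaExpectation_eq_sum, h2, pow_succ]
  field_simp

theorem abs_areaExpectation_sub_le {n : ℕ} (hn : 1 ≤ n) :
    |areaExpectation n - √(2 * Real.pi) / 4 * (n * √n)| ≤ 12 * n := by
  have h1 := abs_le.1 (abs_ramanujanQ_sub_le n.succ_pos)
  have hn' : (1 : ℝ) ≤ n := by exact_mod_cast hn
  have hs : √(2 * Real.pi) ≤ 3 := by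
    rw [Real.sqrt_le_left (by norm_num)]
    linarith [Real.pi_lt_d2]
  have hs0 : 0 ≤ √(2 * Real.pi) := Real.sqrt_nonneg _
  rw [Nat.succ_eq_add_one] at h1
  push_cast at h1
  have ha : √(n : ℝ) ≤ √((n : ℝ) + 1) := Real.sqrt_le_sqrt (by linarith)
  have hb : √((n : ℝ) + 1) ≤ √(n : ℝ) + 1 := by
    rw [Real.sqrt_le_left (by positivity)]
    nlinarith [Real.sq_sqrt (show (0 : ℝ) ≤ n by positivity), Real.sqrt_nonneg (n : ℝ)]
  have hc : √((n : ℝ) + 1) ≤ n + 1 := by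
    rw [Real.sqrt_le_left (by positivity)]
    nlinarith
  rw [areaExpectation_eq_ramanujanQ]
  set s := √(2 * Real.pi)
  set u := √((n : ℝ) + 1)
  set v := √(n : ℝ)
  set q := ramanujanQ (n + 1)
  have hd0 : 0 ≤ (n + 1) * u - n * v := by nlinarith [Real.sqrt_nonneg ((n : ℝ) + 1)]
  have hd1 : (n + 1) * u - n * v ≤ 2 * n + 1 := by nlinarith
  have he0 : 0 ≤ s * ((n + 1) * u - n * v) := mul_nonneg hs0 hd0
  have he1 : s * ((n + 1) * u - n * v) ≤ 3 * (2 * n + 1) := by gcongr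
  have hf := mul_le_mul_of_nonneg_left h1.1 (show (0 : ℝ) ≤ (n + 1) / 2 by positivity)
  have hg := mul_le_mul_of_nonneg_left h1.2 (show (0 : ℝ) ≤ (n + 1) / 2 by positivity)
  rw [abs_le]
  constructor <;> nlinarith

end RamanujanQ

/-! ### Asymptotics of the fifth moment -/

section Asymptotics

open Filter Asymptotics

theorem natCast_pow_isBigO_natCast_pow {k m : ℕ} (h : k ≤ m) :
    (fun n : ℕ => (n : ℝ) ^ k) =O[atTop] fun n : ℕ => (n : ℝ) ^ m := by
  refine IsBigO.of_bound 1 ?_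
  filter_upwards [eventually_ge_atTop 1] with n hn
  rw [one_mul, Real.norm_of_nonneg (by positivity), Real.norm_of_nonneg (by positivity)]
  exact pow_le_pow_right₀ (by exact_mod_cast hn) h

theorem areaExpectation_sub_isBigO :
    (fun n : ℕ => areaExpectation n - √(2 * Real.pi) / 4 * (n * √n))
      =O[atTop] fun n : ℕ => (n : ℝ) ^ 1 := by
  refine IsBigO.of_bound 12 ?_
  filter_upwards [eventually_ge_atTop 1] with n hn
  rw [pow_one, Real.norm_of_nonneg (Nat.cast_nonneg n)]
  exact abs_areaExpectation_sub_le hn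

theorem areaExpectation_isBigO :
    areaExpectation =O[atTop] fun n : ℕ => (n : ℝ) ^ 2 := by
  have h : (fun n : ℕ => √(2 * Real.pi) / 4 * (n * √n)) =O[atTop] fun n : ℕ => (n : ℝ) ^ 2 := by
    refine IsBigO.const_mul_left (IsBigO.of_bound 1 ?_) _
    filter_upwards [eventually_ge_atTop 1] with n hn
    have hn' : (1 : ℝ) ≤ n := by exact_mod_cast hn
    rw [one_mul, Real.norm_of_nonneg (by positivity), Real.norm_of_nonneg (by positivity), sq]
    gcongr
    rw [Real.sqrt_le_left (by positivity)]
    nlinarith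
  simpa using (areaExpectation_sub_isBigO.trans
    (natCast_pow_isBigO_natCast_pow one_le_two)).add h

/-- Only the `n ^ 6` coefficient of `E₁` needs the sharp estimate, and `565/2048 * 1/4 = 565/8192`.
The rest of that factor has degree five, so the crude bound `E₁ = O(n ^ 2)` is enough. -/
theorem areaFactorialMoment_five_sub_isBigO :
    (fun n : ℕ => areaFactorialMoment 5 n
        - 565 / 8192 * √(2 * Real.pi) * (n : ℝ) ^ ((15 : ℝ) / 2))
      =O[atTop] (fun n : ℕ => (n : ℝ) ^ 7) := by
  have hp : ∀ {k m : ℕ} (c : ℝ), k ≤ m →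
      (fun n : ℕ => c * (n : ℝ) ^ k) =O[atTop] fun n : ℕ => (n : ℝ) ^ m :=
    fun c h => (natCast_pow_isBigO_natCast_pow h).const_mul_left c
  have h1 : (fun n : ℕ => -(105845 / 110592) * (n : ℝ) ^ 7 - 2170159 / 290304 * (n : ℝ) ^ 6
        - 99955651 / 3870720 * (n : ℝ) ^ 5 - 30773609 / 725760 * (n : ℝ) ^ 4
        - 94846903 / 11612160 * (n : ℝ) ^ 3 + 24676991 / 483840 * (n : ℝ) ^ 2
        + 392763901 / 11612160 * (n : ℝ) ^ 1) =O[atTop] fun n : ℕ => (n : ℝ) ^ 7 :=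
    ((((((hp _ le_rfl).sub (hp _ (by norm_num))).sub (hp _ (by norm_num))).sub
      (hp _ (by norm_num))).sub (hp _ (by norm_num))).add (hp _ (by norm_num))).add
      (hp _ (by norm_num))
  have h2 : (fun n : ℕ => 1005 / 128 * (n : ℝ) ^ 5
        + 9832585 / 165888 * (n : ℝ) ^ 4 + 1111349 / 5184 * (n : ℝ) ^ 3
        + 826358527 / 1935360 * (n : ℝ) ^ 2 + 159943787 / 362880 * (n : ℝ) ^ 1
        + 1024580441 / 5806080 * (n : ℝ) ^ 0) =O[atTop] fun n : ℕ => (n : ℝ) ^ 5 :=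
    (((((hp _ le_rfl).add (hp _ (by norm_num))).add (hp _ (by norm_num))).add
      (hp _ (by norm_num))).add (hp _ (by norm_num))).add (hp _ (by norm_num))
  have h3 := (hp (k := 6) (565 / 2048) le_rfl).mul areaExpectation_sub_isBigO
  have h4 := h2.mul areaExpectation_isBigO
  simp only [← pow_add, Nat.reduceAdd] at h3 h4
  refine ((h1.add h4).add h3).congr' ?_ EventuallyEq.rfl
  filter_upwards [eventually_ge_atTop 1] with n hn
  have hn' : (0 : ℝ) < n := by exact_mod_cast hn
  have h5 : (n : ℝ) ^ ((15 : ℝ) / 2) = (n : ℝ) ^ 7 * √n := by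
    rw [Real.sqrt_eq_rpow, ← Real.rpow_natCast, ← Real.rpow_add hn']
    norm_num
  rw [areaFactorialMoment_five, h5]
  ring

end Asymptotics

theorem theorem5 :
    (∀ n : ℕ, areaExpectation n =
      -(n : ℝ) / 2 + 1 / 2 * (((n + 1).factorial : ℝ) / ((n : ℝ) + 1) ^ n) *
        ∑ k ∈ Finset.range n, ((n : ℝ) + 1) ^ k / (k.factorial : ℝ)) ∧
    (∀ n : ℕ, areaFactorialMoment 5 n =
      -(105845 / 110592) * (n : ℝ) ^ 7 - 2170159 / 290304 * (n : ℝ) ^ 6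
        - 99955651 / 3870720 * (n : ℝ) ^ 5 - 30773609 / 725760 * (n : ℝ) ^ 4
        - 94846903 / 11612160 * (n : ℝ) ^ 3 + 24676991 / 483840 * (n : ℝ) ^ 2
        + 392763901 / 11612160 * (n : ℝ)
      + (565 / 2048 * (n : ℝ) ^ 6 + 1005 / 128 * (n : ℝ) ^ 5
        + 9832585 / 165888 * (n : ℝ) ^ 4 + 1111349 / 5184 * (n : ℝ) ^ 3
        + 826358527 / 1935360 * (n : ℝ) ^ 2 + 159943787 / 362880 * (n : ℝ)
        + 1024580441 / 5806080) * areaExpectation n) ∧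
    (fun n : ℕ => areaFactorialMoment 5 n
        - 565 / 8192 * Real.sqrt (2 * Real.pi) * (n : ℝ) ^ ((15 : ℝ) / 2))
      =O[Filter.atTop] (fun n : ℕ => (n : ℝ) ^ 7) :=
  ⟨areaExpectation_eq_sum, areaFactorialMoment_five, areaFactorialMoment_five_sub_isBigO⟩
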